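/- Let $0<r<1$, and let $\alpha:[0,1]\to(1,2)$ be three times differentiable with $|\alpha'|+|\alpha''|+|\alpha'''|\le L$ on $[0,1]$ for some constant $L$. Put $\alpha_0=\alpha(0)$, $\alpha_1=\alpha(1)$ and $\alpha^*=\tfrac12\max\{\alpha_0,\alpha_1\}\in(\tfrac12,1)$. Consider the two-sided variable-exponent space-fractional diffusion–advection–reaction problem on $\Omega=(0,1)$ $$-\partial_x\big(rI_x^{2-\alpha(x)}+(1-r)\hat I_x^{2-\alpha(x)}\big)\partial_xu+b\,\partial_xu+c\,u=f,\qquad u(0)=u(1)=0,$$ where $$I_x^{2-\alpha(x)}q=\int_0^x\frac{(x-s)^{1-\alpha(x-s)}}{\Gamma(2-\alpha(x-s))}q(s)\,ds,\qquad \hat I_x^{2-\alpha(x)}q=\int_x^1\frac{(s-x)^{1-\alpha(1-(s-x))}}{\Gamma(2-\alpha(1-(s-x)))}q(s)\,ds .$$ For $\mu>0$ let $I_x^\mu q=\int_0^x\frac{(x-s)^{\mu-1}}{\Gamma(\mu)}q(s)\,ds$ and $\hat I_x^\mu q=\int_x^1\frac{(s-x)^{\mu-1}}{\Gamma(\mu)}q(s)\,ds$,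 and let $$g_l(x)=\int_0^x\partial_z\frac{x^{1-\alpha(z)}}{\Gamma(2-\alpha(z))}\,dz,\qquad g_r(x)=\int_0^x\partial_z\frac{x^{1-\alpha(1-z)}}{\Gamma(2-\alpha(1-z))}\,dz .$$ For $u,v\in C_c^\infty(\Omega)$, with $(\cdot,\cdot)$ the inner product of $L^2(\Omega)$, set $$\begin{aligned}a(u,v)=\;&r\big(I_x^{1-\alpha_0/2}\partial_xu,\hat I_x^{1-\alpha_0/2}\partial_xv\big)+(1-r)\big(\hat I_x^{1-\alpha_1/2}\partial_xu,I_x^{1-\alpha_1/2}\partial_xv\big)\\&-r\Big(\int_0^xg_l'(x-s)\partial_su(s)\,ds,\,v\Big)+(1-r)\Big(\int_x^1g_r'(s-x)\partial_su(s)\,ds,\,v\Big)+(b\,\partial_xu,v)+(c\,u,v).\end{aligned}$$ Let $H_0^{\alpha^*}$ be the completion of $C_c^\infty(\Omega)$ (functions extended by zero to $\mathbb R$) in the norm $$\|u\|_{H^{\alpha^*}}^2=\|u\|_{L^2(\mathbb R)}^2+\iint_{\mathbb R^2}\frac{|u(x)-u(y)|^2}{|x-y|^{1+2\alpha^*}}\,dx\,dy,$$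 which up to equivalence of norms is the interpolation space of order $\alpha^*$ between $L^2(\Omega)$ and $H^1_0(\Omega)$, and let $H^{-\alpha^*}$ be its dual with the dual norm; write $(f,v)$ for the duality pairing. Then there is a constant $\bar c>0$, depending only on $\alpha$ and $r$, such that for all $b\in C^1[0,1]$ and all bounded measurable $c$ with $c-\tfrac12b'\ge\bar c$ on $[0,1]$: 1. $a$ extends uniquely to a continuous bilinear form on $H_0^{\alpha^*}$, again denoted by $a$, and there are constants $c_*,c^*>0$ with $a(u,u)\ge c_*\|u\|_{H^{\alpha^*}}^2$ and $|a(u,v)|\le c^*\|u\|_{H^{\alpha^*}}\|v\|_{H^{\alpha^*}}$ for all $u,v\in H_0^{\alpha^*}$. 2. There is a constant $Q>0$ such that for every $f\in H^{-\alpha^*}$ there is exactly one $u\in H_0^{\alpha^*}$ with $a(u,v)=(f,v)$ for all $v\in H_0^{\alpha^*}$, and it satisfies $\|u\|_{H^{\alpha^*}}\le Q\|f\|_{H^{-\alpha^*}}$. -/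

import Mathlib

open Set MeasureTheory

noncomputable section

namespace FracBVP

/-! ### The spaces `H^s_0(0,1)` and their duals -/

/-- The open interval `Ω = (0,1)`. -/
def Omega : TopologicalSpace.Opens ℝ := ⟨Ioo 0 1, isOpen_Ioo⟩

/-- Test functions `C_c^∞(Ω)`, regarded as functions on `ℝ` vanishing outside `Ω`. -/
abbrev Test : Type := TestFunction Omega ℝ (⊤ : ℕ∞)

/-- The integrand of the Sobolev-Slobodeckij seminorm of order `s`: the function
`(x, y) ↦ (u(x) - u(y)) / |x - y|^(1/2 + s)`, whose squared `L²(ℝ²)` norm is the squared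
seminorm of `u`. -/
def diffQuot (s : ℝ) (u : ℝ → ℝ) (p : ℝ × ℝ) : ℝ :=
  (u p.1 - u p.2) / |p.1 - p.2| ^ (1 / 2 + s)

/-- The Hilbert space `L²(ℝ) × L²(ℝ²)` with norm `(‖u‖² + ‖w‖²)^(1/2)`. -/
abbrev PairSpace : Type :=
  WithLp 2 (Lp ℝ 2 (volume : Measure ℝ) × Lp ℝ 2 (volume : Measure (ℝ × ℝ)))

/-- `C_c^∞(Ω)` with the norm of `H^s(ℝ)`: a test function `φ` is identified with the pair
consisting of `φ` and its difference quotient, so that the norm of the pair is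
`(‖φ‖²_{L²} + ∬ |φ(x) - φ(y)|² / |x - y|^(1 + 2 s) dx dy)^(1/2)`. -/
def testSpace (s : ℝ) : Submodule ℝ PairSpace where
  carrier := {p | ∃ φ : Test, (p.fst : ℝ → ℝ) =ᵐ[volume] (φ : ℝ → ℝ) ∧
    (p.snd : ℝ × ℝ → ℝ) =ᵐ[volume] diffQuot s φ}
  add_mem' := by
    rintro p q ⟨φ, h1, h2⟩ ⟨ψ, k1, k2⟩
    refine ⟨φ + ψ, ?_, ?_⟩
    · filter_upwards [Lp.coeFn_add p.fst q.fst, h1, k1] with x hx h k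
      simp only [WithLp.add_fst, hx, Pi.add_apply, h, k, FunLike.coe_add]
    · filter_upwards [Lp.coeFn_add p.snd q.snd, h2, k2] with x hx h k
      simp only [WithLp.add_snd, hx, Pi.add_apply, h, k, diffQuot, FunLike.coe_add]
      ring
  zero_mem' := by
    refine ⟨0, ?_, ?_⟩
    · simp only [WithLp.zero_fst]
      exact Lp.coeFn_zero ℝ 2 (volume : Measure ℝ)
    · filter_upwards [Lp.coeFn_zero ℝ 2 (volume : Measure (ℝ × ℝ))] with x hx
      simp only [WithLp.zero_snd, hx, diffQuot, FunLike.coe_zero, Pi.zero_apply, sub_zero, zero_div]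
  smul_mem' := by
    rintro c p ⟨φ, h1, h2⟩
    refine ⟨c • φ, ?_, ?_⟩
    · filter_upwards [Lp.coeFn_smul c p.fst, h1] with x hx h
      simp [hx, h]
    · filter_upwards [Lp.coeFn_smul c p.snd, h2] with x hx h
      simp only [WithLp.smul_snd, hx, Pi.smul_apply, h, diffQuot, FunLike.coe_smul, smul_eq_mul]
      ring

/-- The Hilbert space `H^s_0(Ω)`, for `1/2 < s < 1`: the closure of `C_c^∞(Ω)` in the
Sobolev-Slobodeckij norm of the extension by zero.  An element is a pair `(u, w)`, where
`u ∈ L²(ℝ)` vanishes outside `Ω` and `w` is the difference quotient of `u`; hence it is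
determined by `u`, and its norm is the `H^s` norm of `u`.
For these `s` this is the interpolation space between `L²(Ω)` and `H^1_0(Ω)`. -/
abbrev H0 (s : ℝ) : Type := (testSpace s).topologicalClosure

/-- The function underlying an element of `H^s_0(Ω)`. -/
def H0.fn {s : ℝ} (u : H0 s) : ℝ → ℝ := (u : PairSpace).fst

theorem integrable_majorant {s : ℝ} (hs : s ∈ Ioo (0 : ℝ) 1) {A B : ℝ} (hA : 0 ≤ A) (hB : 0 ≤ B) :
    Integrable (fun h : ℝ => min (A * h ^ 2) B / |h| ^ (1 + 2 * s)) := by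
  set F : ℝ → ℝ := fun h => min (A * h ^ 2) B / |h| ^ (1 + 2 * s) with hF
  have hmeas : Measurable F := by fun_prop
  have hnn : ∀ h, 0 ≤ F h := fun h => by simp only [hF]; positivity
  have h1 : IntegrableOn F (Ioc 0 1) := by
    have : IntegrableOn (fun h : ℝ => A * h ^ (1 - 2 * s)) (Ioc 0 1) :=
      ((intervalIntegrable_iff_integrableOn_Ioc_of_le zero_le_one).1
        (intervalIntegral.intervalIntegrable_rpow' (by linarith [hs.2]))).const_mul A
    refine this.mono' hmeas.aestronglyMeasurable ?_
    filter_upwards [ae_restrict_mem measurableSet_Ioc] with h hh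
    rw [Real.norm_of_nonneg (hnn h)]
    simp only [hF]
    rw [abs_of_pos hh.1, div_le_iff₀ (Real.rpow_pos_of_pos hh.1 _), mul_assoc,
      ← Real.rpow_add hh.1]
    refine (min_le_left _ _).trans (le_of_eq ?_)
    congr 1
    rw [← Real.rpow_natCast]
    congr 1
    push_cast
    ring
  have h2 : IntegrableOn F (Ioi 1) := by
    have : IntegrableOn (fun h : ℝ => B * h ^ (-(1 + 2 * s))) (Ioi 1) :=
      (integrableOn_Ioi_rpow_of_lt (by linarith [hs.1]) one_pos).const_mul B
    refine this.mono' hmeas.aestronglyMeasurable ?_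
    filter_upwards [ae_restrict_mem measurableSet_Ioi] with h hh
    have hh0 : 0 < h := zero_lt_one.trans hh
    rw [Real.norm_of_nonneg (hnn h)]
    simp only [hF]
    rw [abs_of_pos hh0, div_le_iff₀ (Real.rpow_pos_of_pos hh0 _), mul_assoc,
      ← Real.rpow_add hh0]
    simp
  have h3 : IntegrableOn F (Ioi 0) := by
    rw [← Ioc_union_Ioi_eq_Ioi zero_le_one]
    exact h1.union h2
  have h4 : IntegrableOn F (Iic 0) := by
    rw [← Measure.map_neg_eq_self (volume : Measure ℝ)]
    let m : MeasurableEmbedding fun x : ℝ => -x := (Homeomorph.neg ℝ).measurableEmbedding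
    rw [m.integrableOn_map_iff]
    simp_rw [hF, Function.comp_def, abs_neg, neg_sq, neg_preimage, neg_Iic, neg_zero]
    exact Iff.mpr integrableOn_Ici_iff_integrableOn_Ioi h3
  rw [← integrableOn_univ, ← Iic_union_Ioi (a := (0 : ℝ))]
  exact h4.union h3

theorem memLp_diffQuot {s : ℝ} (hs : s ∈ Ioo (0 : ℝ) 1) (φ : Test) :
    MemLp (diffQuot s φ) 2 (volume : Measure (ℝ × ℝ)) := by
  have hmeas : AEStronglyMeasurable (diffQuot s φ) (volume : Measure (ℝ × ℝ)) := by
    apply Measurable.aestronglyMeasurable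
    unfold diffQuot
    have := φ.continuous.measurable
    fun_prop
  rw [memLp_two_iff_integrable_sq hmeas]
  obtain ⟨M, hM⟩ := φ.continuous.bounded_above_of_compact_support φ.hasCompactSupport
  obtain ⟨K, hK⟩ := (φ.contDiff.of_le (by norm_cast) : ContDiff ℝ 1 φ).lipschitzWith_of_hasCompactSupport φ.hasCompactSupport one_ne_zero
  set ρ : ℝ → ℝ := fun h => min ((K : ℝ) ^ 2 * h ^ 2) ((2 * M) ^ 2) / |h| ^ (1 + 2 * s) with hρ
  have hρi : Integrable ρ := integrable_majorant hs (by positivity) (by positivity)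
  have hind : Integrable ((Icc (0 : ℝ) 1).indicator (fun _ => (1 : ℝ))) :=
    (integrable_indicator_iff measurableSet_Icc).2 (by simp)
  have h1 := hind.convolution_integrand (ContinuousLinearMap.mul ℝ ℝ) hρi
  have h2 := h1.swap
  refine (h1.add h2).mono' (hmeas.pow 2) (Filter.Eventually.of_forall ?_)
  rintro ⟨x, y⟩
  have hpos : ∀ h, 0 ≤ ρ h := fun h => by simp only [hρ]; positivity
  have hsymm : ρ (y - x) = ρ (x - y) := by
    simp only [hρ, abs_sub_comm y x]; congr 2; ring
  have key : diffQuot s φ (x, y) ^ 2 ≤ ρ (x - y) := by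
    simp only [diffQuot, hρ, div_pow]
    have e : (|x - y| ^ (1 / 2 + s)) ^ 2 = |x - y| ^ (1 + 2 * s) := by
      rw [← Real.rpow_natCast, ← Real.rpow_mul (abs_nonneg _)]; congr 1; push_cast; ring
    rw [e]
    gcongr
    refine le_min ?_ ?_
    · have := hK.dist_le_mul x y
      rw [Real.dist_eq, Real.dist_eq] at this
      rw [← sq_abs (φ x - φ y), ← sq_abs (x - y), ← mul_pow]
      gcongr
    · have h1 := hM x
      have h2 := hM y
      rw [Real.norm_eq_abs] at h1 h2
      rw [← sq_abs (φ x - φ y)]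
      have : |φ x - φ y| ≤ |φ x| + |φ y| := abs_sub _ _
      gcongr
      linarith
  have hz : ∀ z, z ∉ Icc (0 : ℝ) 1 → φ z = 0 := fun z hz =>
    image_eq_zero_of_notMem_tsupport fun h => hz (Ioo_subset_Icc_self (φ.tsupport_subset h))
  simp only [Real.norm_eq_abs, abs_pow, sq_abs, Pi.add_apply, Function.comp, Prod.swap,
    ContinuousLinearMap.mul_apply', hsymm]
  by_cases hx : x ∈ Icc (0 : ℝ) 1
  · have : 0 ≤ (Icc (0 : ℝ) 1).indicator (fun _ => (1 : ℝ)) y := indicator_nonneg (by simp) _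
    rw [indicator_of_mem hx]
    nlinarith [hpos (x - y)]
  · by_cases hy : y ∈ Icc (0 : ℝ) 1
    · rw [indicator_of_mem hy, indicator_of_notMem hx]
      linarith
    · simp only [diffQuot, hz x hx, hz y hy, indicator_of_notMem hx, indicator_of_notMem hy]
      simp

/-- Every test function is an element of `H^s_0(Ω)`. -/
theorem exists_fn_eq_test {s : ℝ} (hs : s ∈ Ioo (0 : ℝ) 1) (φ : Test) :
    ∃ u : H0 s, u.fn =ᵐ[volume] (φ : ℝ → ℝ) := by
  have h1 : MemLp (φ : ℝ → ℝ) 2 volume := φ.continuous.memLp_of_hasCompactSupport φ.hasCompactSupport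
  have h2 := memLp_diffQuot hs φ
  refine ⟨⟨WithLp.toLp 2 (h1.toLp, h2.toLp), (testSpace s).le_topologicalClosure ⟨φ, ?_, ?_⟩⟩, ?_⟩
  · exact h1.coeFn_toLp
  · exact h2.coeFn_toLp
  · exact h1.coeFn_toLp

/-- An element `(u, w)` of `H^s_0(Ω)` is determined by the function `u`. -/
theorem fn_ext {s : ℝ} (u v : H0 s) (h : u.fn =ᵐ[volume] v.fn) : u = v := by
  have main : ∀ u : H0 s, ((u : PairSpace).snd : ℝ × ℝ → ℝ) =ᵐ[volume] diffQuot s u.fn := by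
    intro u
    have := u.2
    rw [← SetLike.mem_coe, Submodule.topologicalClosure_coe, mem_closure_iff_seq_limit] at this
    obtain ⟨p, hp, hl⟩ := this
    choose φ hφ hφ2 using hp
    have l1 : Filter.Tendsto (fun n => (p n).fst) Filter.atTop (nhds (u : PairSpace).fst) :=
      ((WithLp.prod_continuous_ofLp 2 _ _).fst.tendsto _).comp hl
    have l2 : Filter.Tendsto (fun n => (p n).snd) Filter.atTop (nhds (u : PairSpace).snd) :=
      ((WithLp.prod_continuous_ofLp 2 _ _).snd.tendsto _).comp hl
    obtain ⟨n1, hn1, t1⟩ := (tendstoInMeasure_of_tendsto_Lp l1).exists_seq_tendsto_ae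
    obtain ⟨n2, hn2, t2⟩ := (tendstoInMeasure_of_tendsto_Lp (l2.comp hn1.tendsto_atTop)).exists_seq_tendsto_ae
    have q1 := Measure.quasiMeasurePreserving_fst (μ := (volume : Measure ℝ)) (ν := (volume : Measure ℝ))
    have q2 := Measure.quasiMeasurePreserving_snd (μ := (volume : Measure ℝ)) (ν := (volume : Measure ℝ))
    have a1 := ae_all_iff.2 hφ
    have a2 := ae_all_iff.2 hφ2
    rw [← Measure.volume_eq_prod] at q1 q2
    filter_upwards [t2, a2, q1.ae t1, q2.ae t1, q1.ae a1, q2.ae a1] with x b1 b2 b3 b4 b5 b6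
    refine tendsto_nhds_unique b1 ?_
    simp only [Function.comp, b2, diffQuot, H0.fn]
    simp only [b5, b6] at b3 b4
    exact ((b3.comp hn2.tendsto_atTop).sub (b4.comp hn2.tendsto_atTop)).div_const _
  have e1 : (u : PairSpace).fst = (v : PairSpace).fst := Lp.ext h
  have e2 : (u : PairSpace).snd = (v : PairSpace).snd := by
    apply Lp.ext
    refine (main u).trans (Filter.EventuallyEq.trans ?_ (main v).symm)
    simp only [H0.fn, e1]; rfl
  apply Subtype.ext
  apply WithLp.ofLp_injective
  exact Prod.ext e1 e2

/-- `H^{-s}(Ω)`, the dual space of `H^s_0(Ω)`, with the dual norm. -/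
abbrev Hneg (s : ℝ) : Type := StrongDual ℝ (H0 s)

/-! ### Fractional integrals and the bilinear form -/

/-- The left-sided fractional integral of order `μ` on `(0,1)`. -/
def leftInt (μ : ℝ) (q : ℝ → ℝ) (x : ℝ) : ℝ :=
  ∫ t in (0 : ℝ)..x, (x - t) ^ (μ - 1) / Real.Gamma μ * q t

/-- The right-sided fractional integral of order `μ` on `(0,1)`. -/
def rightInt (μ : ℝ) (q : ℝ → ℝ) (x : ℝ) : ℝ :=
  ∫ t in x..(1 : ℝ), (t - x) ^ (μ - 1) / Real.Gamma μ * q t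

/-- `α` is three times differentiable on `[0,1]` with values in `(1,2)` and
`|α'| + |α''| + |α'''| ≤ L`. -/
structure IsExponent (α : ℝ → ℝ) (L : ℝ) : Prop where
  mem : ∀ x ∈ Icc (0 : ℝ) 1, α x ∈ Ioo (1 : ℝ) 2
  diff : ∀ k < 3, DifferentiableOn ℝ (iteratedDerivWithin k α (Icc 0 1)) (Icc 0 1)
  bound : ∀ x ∈ Icc (0 : ℝ) 1, |iteratedDerivWithin 1 α (Icc 0 1) x|
    + |iteratedDerivWithin 2 α (Icc 0 1) x| + |iteratedDerivWithin 3 α (Icc 0 1) x| ≤ L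

/-- The order `α* = max {α(0), α(1)} / 2`. -/
def orderStar (α : ℝ → ℝ) : ℝ := max (α 0) (α 1) / 2

/-- `g_l(x) = ∫_0^x ∂_z [x^(1 - α(z)) / Γ(2 - α(z))] dz`, the difference between the
variable-exponent kernel `x^(1 - α(x)) / Γ(2 - α(x))` and `x^(1 - α(0)) / Γ(2 - α(0))`. -/
def gLeft (α : ℝ → ℝ) (x : ℝ) : ℝ :=
  ∫ z in (0 : ℝ)..x, deriv (fun y => x ^ (1 - α y) / Real.Gamma (2 - α y)) z

/-- `g_r(x) = ∫_0^x ∂_z [x^(1 - α(1 - z)) / Γ(2 - α(1 - z))] dz`. -/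
def gRight (α : ℝ → ℝ) (x : ℝ) : ℝ :=
  ∫ z in (0 : ℝ)..x, deriv (fun y => x ^ (1 - α (1 - y)) / Real.Gamma (2 - α (1 - y))) z

/-- The bilinear form of the problem, for test functions `u` and `v`:
`r (I^(1-α₀/2) u', Î^(1-α₀/2) v') + (1-r) (Î^(1-α₁/2) u', I^(1-α₁/2) v')`
`- r (∫_0^x g_l'(x-t) u'(t) dt, v) + (1-r) (∫_x^1 g_r'(t-x) u'(t) dt, v)`
`+ (b u', v) + (c u, v)`. -/
def form (α : ℝ → ℝ) (r : ℝ) (b c u v : ℝ → ℝ) : ℝ :=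
  r * (∫ x in (0 : ℝ)..1,
      leftInt (1 - α 0 / 2) (deriv u) x * rightInt (1 - α 0 / 2) (deriv v) x)
  + (1 - r) * (∫ x in (0 : ℝ)..1,
      rightInt (1 - α 1 / 2) (deriv u) x * leftInt (1 - α 1 / 2) (deriv v) x)
  - r * (∫ x in (0 : ℝ)..1,
      (∫ t in (0 : ℝ)..x, deriv (gLeft α) (x - t) * deriv u t) * v x)
  + (1 - r) * (∫ x in (0 : ℝ)..1,
      (∫ t in x..(1 : ℝ), deriv (gRight α) (t - x) * deriv u t) * v x)
  + (∫ x in (0 : ℝ)..1, b x * deriv u x * v x)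
  + (∫ x in (0 : ℝ)..1, c x * u x * v x)

/-- A continuous bilinear form `a` on `H^s_0(Ω)` extends `form` from `C_c^∞(Ω)`.  By density of
`C_c^∞(Ω)` there is at most one such `a`. -/
def Extends (α : ℝ → ℝ) (r : ℝ) (b c : ℝ → ℝ) {s : ℝ} (a : H0 s →L[ℝ] H0 s →L[ℝ] ℝ) : Prop :=
  ∀ (φ ψ : Test) (u v : H0 s), u.fn =ᵐ[volume] (φ : ℝ → ℝ) → v.fn =ᵐ[volume] (ψ : ℝ → ℝ) →
    a u v = form α r b c φ ψ

/-- `u` solves the variational problem `a(u, v) = (f, v)` for all `v ∈ H^s_0(Ω)`. -/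
def IsSolution {s : ℝ} (a : H0 s →L[ℝ] H0 s →L[ℝ] ℝ) (f : Hneg s) (u : H0 s) : Prop :=
  ∀ v : H0 s, a u v = f v

end FracBVP

end

/-!
The form is a sum of pairings in `L²(0,1)` of operators `H^s_0 → L²(0,1)` with `s = α*`, so it
suffices to bound these operators on test functions and to extend them by density
(`IsBddOp.exists_clm`, `IsBddOp.isInduced`); coercivity then also passes to the completion, and the
Lax-Milgram theorem gives the solution.  No Fourier transform is used.

*Leading part.*  Write `β = α(0)/2` or `β = α(1)/2`.  By Fubini and the scaling of power kernels
(`integral_conv_mul_conv`, `integral_powPos_left_right`, `integral_powPos_left_left`), both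
`(I^(1-β) u', Î^(1-β) u')` and `‖I^(1-β) u'‖²` reduce to a double integral of
`|x - t|^(1-2β) u'(x) u'(t)`.  In the increment `h = x - t` this is the integral of `h^(1-2β) ψ''(h)`
with `ψ(h) = ‖u - u(· + h)‖²`, and two integrations by parts turn it into a positive multiple of
`∫ |h|^(-1-2β) ψ(h) dh`, the squared seminorm of order `β` (`integral_energy`).  This gives coercivity
with respect to the seminorm of order `s` and continuity in the critical case `β = s`.

*Lower order terms.*  If `|κ(z)| ≤ C z^(-σ)` and `|κ'(z)| ≤ C z^(-σ-1)` with `σ < s`, then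
`∫_0^x κ(x-t) u'(t) dt = κ(x) u(x) + ∫_0^x κ'(x-t) (u(t) - u(x)) dt`, and the Cauchy-Schwarz
inequality bounds the `L²` norm of this by the seminorm of order `s` (`exists_bound_convL`).  The
kernel `g_l'` is of this type for every `σ > α(0) - 1`, by the symbol calculus of `IsSymbol`
(`exists_bound_deriv_gLeft`), and `α(0) - 1 < α(0)/2 ≤ s` because `α(0) < 2`.  Hence the perturbation
terms in `a(u, u)` are at most a multiple of the seminorm times the `L²` norm, and are absorbed once
`c - b'/2` is large (`IsExponent.exists_coercive`).

*Advection.*  The pairing `∫ b u' v` is a multiple of the product of the left-sided derivative of `u`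
of order `s` and the right-sided derivative of `b v` of order `1 - s < s`
(`integral_convL_mul_convR_one`), and multiplication by `b` is bounded in the `H^s` norm
(`exists_semi_mul_le`).
-/

namespace FracBVP

/-! ### The classical functions and the Sobolev-Slobodeckij seminorm -/

/-- A continuously differentiable function on `ℝ` that vanishes outside `(0,1)`. -/
structure IsC1Zero (u : ℝ → ℝ) : Prop where
  contDiff : ContDiff ℝ 1 u
  zero_off : ∀ x ∉ Ioo (0 : ℝ) 1, u x = 0

/-- The square of the Sobolev-Slobodeckij seminorm of order `s`. -/
noncomputable def semi (s : ℝ) (u : ℝ → ℝ) : ℝ := ∫ p : ℝ × ℝ, diffQuot s u p ^ 2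

theorem semi_nonneg (s : ℝ) (u : ℝ → ℝ) : 0 ≤ semi s u := integral_nonneg fun _ => sq_nonneg _

theorem isC1Zero_test (φ : Test) : IsC1Zero φ where
  contDiff := φ.contDiff.of_le (by norm_cast)
  zero_off x hx := image_eq_zero_of_notMem_tsupport fun h => hx (φ.tsupport_subset h)

namespace IsC1Zero

variable {u : ℝ → ℝ} (hu : IsC1Zero u)
include hu

theorem hasDerivAt (x : ℝ) : HasDerivAt u (deriv u x) x :=
  (hu.contDiff.differentiable one_ne_zero x).hasDerivAt

theorem continuous : Continuous u := hu.contDiff.continuous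

theorem continuous_deriv : Continuous (deriv u) := hu.contDiff.continuous_deriv le_rfl

theorem hasCompactSupport : HasCompactSupport u :=
  HasCompactSupport.intro isCompact_Icc fun x hx => hu.zero_off x fun h => hx (Ioo_subset_Icc_self h)

theorem deriv_zero_off {x : ℝ} (hx : x ∉ Ioo (0 : ℝ) 1) : deriv u x = 0 := by
  have key : ∀ S : Set ℝ, S ⊆ (Ioo (0 : ℝ) 1)ᶜ → UniqueDiffWithinAt ℝ S x → x ∈ S →
      deriv u x = 0 := by
    intro S hS hU hx
    have h1 : HasDerivWithinAt u (deriv u x) S x := (hu.hasDerivAt x).hasDerivWithinAt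
    have h2 : HasDerivWithinAt u 0 S x :=
      (hasDerivWithinAt_const x S (0 : ℝ)).congr (fun y hy => hu.zero_off y (hS hy))
        (hu.zero_off x (hS hx))
    exact hU.eq_deriv S h1 h2
  by_cases h0 : x ≤ 0
  · exact key (Iic 0) (fun y hy h => absurd h.1 (not_lt.2 hy)) (uniqueDiffOn_Iic 0 x h0) h0
  · have h1 : 1 ≤ x := by
      by_contra h
      exact hx ⟨by linarith, by linarith⟩
    exact key (Ici 1) (fun y hy h => absurd h.2 (not_lt.2 hy)) (uniqueDiffOn_Ici 1 x h1) h1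

theorem exists_bound_deriv : ∃ K, 0 ≤ K ∧ ∀ x, |deriv u x| ≤ K := by
  have hc : HasCompactSupport (deriv u) := hu.hasCompactSupport.deriv
  obtain ⟨K, hK⟩ := hu.continuous_deriv.bounded_above_of_compact_support hc
  exact ⟨K, (norm_nonneg _).trans (hK 0), hK⟩

theorem abs_sub_le {K : ℝ} (hK : ∀ x, |deriv u x| ≤ K) (x y : ℝ) : |u x - u y| ≤ K * |x - y| := by
  have := Convex.norm_image_sub_le_of_norm_hasDerivWithin_le (f := u) (f' := deriv u)
    (fun z _ => (hu.hasDerivAt z).hasDerivWithinAt) (fun z _ => hK z) convex_univ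
    (mem_univ y) (mem_univ x)
  simpa using this

theorem reflect : IsC1Zero (fun x => u (1 - x)) where
  contDiff := hu.contDiff.comp (contDiff_const.sub contDiff_id)
  zero_off x hx := hu.zero_off _ fun h => hx ⟨by linarith [h.2], by linarith [h.1]⟩

theorem deriv_reflect (x : ℝ) : deriv (fun x => u (1 - x)) x = -deriv u (1 - x) := by
  have h : HasDerivAt (fun x => u (1 - x)) (deriv u (1 - x) * -1) x :=
    (hu.hasDerivAt (1 - x)).comp x ((hasDerivAt_id x).const_sub 1)
  rw [h.deriv, mul_neg_one]

end IsC1Zero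

theorem semi_reflect (s : ℝ) (u : ℝ → ℝ) : semi s (fun x => u (1 - x)) = semi s u := by
  unfold semi
  have h1 : MeasurePreserving (fun x : ℝ => 1 - x) volume volume :=
    Measure.measurePreserving_sub_left volume 1
  have h2 : MeasurePreserving (Prod.map (fun x : ℝ => 1 - x) (fun x : ℝ => 1 - x))
      (volume : Measure (ℝ × ℝ)) volume := by
    rw [Measure.volume_eq_prod]; exact h1.prod h1
  have h3 : MeasurableEmbedding (Prod.map (fun x : ℝ => 1 - x) (fun x : ℝ => 1 - x)) := by
    exact ((MeasurableEquiv.subLeft (1 : ℝ)).prodCongr (MeasurableEquiv.subLeft (1 : ℝ))).measurableEmbedding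
  rw [← h2.integral_comp h3]
  refine integral_congr_ae (Filter.Eventually.of_forall fun p => ?_)
  simp only [diffQuot, Prod.map]
  rw [show (1 - p.1 - (1 - p.2)) = p.2 - p.1 by ring, abs_sub_comm p.2, sub_sub_cancel,
    sub_sub_cancel]

/-! ### Test functions inside `H^s_0` and the extension of operators -/

/-- A bilinear expression on a set `X` of vectors of `V` is induced by a continuous bilinear form. -/
def IsInduced {X V : Type*} [NormedAddCommGroup V] [NormedSpace ℝ V] (j : X → V)
    (B : X → X → ℝ) : Prop :=
  ∃ a : V →L[ℝ] V →L[ℝ] ℝ, ∀ φ ψ, a (j φ) (j ψ) = B φ ψ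

namespace IsInduced

variable {X V : Type*} [NormedAddCommGroup V] [NormedSpace ℝ V] {j : X → V} {B B' : X → X → ℝ}

theorem add (h : IsInduced j B) (h' : IsInduced j B') : IsInduced j (fun φ ψ => B φ ψ + B' φ ψ) := by
  obtain ⟨a, ha⟩ := h
  obtain ⟨a', ha'⟩ := h'
  exact ⟨a + a', fun φ ψ => by rw [_root_.add_apply, _root_.add_apply, ha, ha']⟩

theorem sub (h : IsInduced j B) (h' : IsInduced j B') : IsInduced j (fun φ ψ => B φ ψ - B' φ ψ) := by
  obtain ⟨a, ha⟩ := h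
  obtain ⟨a', ha'⟩ := h'
  exact ⟨a - a', fun φ ψ => by rw [_root_.sub_apply, _root_.sub_apply, ha, ha']⟩

theorem const_mul (h : IsInduced j B) (k : ℝ) : IsInduced j (fun φ ψ => k * B φ ψ) := by
  obtain ⟨a, ha⟩ := h
  exact ⟨k • a, fun φ ψ => by rw [_root_.smul_apply, _root_.smul_apply, ha, smul_eq_mul]⟩

theorem congr (h : IsInduced j B) (he : ∀ φ ψ, B φ ψ = B' φ ψ) : IsInduced j B' :=
  h.imp fun _ ha φ ψ => (ha φ ψ).trans (he φ ψ)

theorem flip (h : IsInduced j B) : IsInduced j (fun φ ψ => B ψ φ) := by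
  obtain ⟨a, ha⟩ := h
  exact ⟨a.flip, fun φ ψ => by rw [ContinuousLinearMap.flip_apply, ha]⟩

end IsInduced

/-- The embedding of `C_c^∞(Ω)` into `H^s_0(Ω)`. -/
noncomputable def ofTest {s : ℝ} (hs : s ∈ Ioo (0 : ℝ) 1) : Test →ₗ[ℝ] H0 s where
  toFun φ := (exists_fn_eq_test hs φ).choose
  map_add' φ ψ := by
    refine fn_ext _ _ ?_
    refine (exists_fn_eq_test hs (φ + ψ)).choose_spec.trans ?_
    refine Filter.EventuallyEq.trans ?_ (Lp.coeFn_add _ _).symm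
    filter_upwards [(exists_fn_eq_test hs φ).choose_spec, (exists_fn_eq_test hs ψ).choose_spec]
      with x h1 h2
    exact congrArg₂ (· + ·) h1.symm h2.symm
  map_smul' c φ := by
    refine fn_ext _ _ ?_
    refine (exists_fn_eq_test hs (c • φ)).choose_spec.trans ?_
    refine Filter.EventuallyEq.trans ?_ (Lp.coeFn_smul _ _).symm
    filter_upwards [(exists_fn_eq_test hs φ).choose_spec] with x h1
    exact congrArg (c • ·) h1.symm

section
variable {s : ℝ} (hs : s ∈ Ioo (0 : ℝ) 1)

theorem ofTest_fn (φ : Test) : (ofTest hs φ).fn =ᵐ[volume] (φ : ℝ → ℝ) :=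
  (exists_fn_eq_test hs φ).choose_spec

theorem eq_ofTest {φ : Test} {u : H0 s} (h : u.fn =ᵐ[volume] (φ : ℝ → ℝ)) : u = ofTest hs φ :=
  fn_ext _ _ (h.trans (ofTest_fn hs φ).symm)

theorem ofTest_eq (φ : Test) (p : PairSpace) (h1 : (p.fst : ℝ → ℝ) =ᵐ[volume] (φ : ℝ → ℝ))
    (h2 : (p.snd : ℝ × ℝ → ℝ) =ᵐ[volume] diffQuot s φ) : (ofTest hs φ : PairSpace) = p := by
  have hp : p ∈ (testSpace s).topologicalClosure :=
    (testSpace s).le_topologicalClosure ⟨φ, h1, h2⟩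
  exact (congrArg Subtype.val (eq_ofTest hs (u := ⟨p, hp⟩) h1)).symm

theorem norm_ofTest_sq (φ : Test) : ‖ofTest hs φ‖ ^ 2 = (∫ x, φ x ^ 2) + semi s φ := by
  have h1 : MemLp (φ : ℝ → ℝ) 2 volume :=
    φ.continuous.memLp_of_hasCompactSupport φ.hasCompactSupport
  have h2 := memLp_diffQuot hs φ
  have key : ∀ {X : Type} [MeasureSpace X] (f : X → ℝ) (hf : MemLp f 2 volume),
      ‖hf.toLp‖ ^ 2 = ∫ x, f x ^ 2 := by
    intro X _ f hf
    rw [← real_inner_self_eq_norm_sq, L2.inner_def]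
    refine integral_congr_ae ?_
    filter_upwards [hf.coeFn_toLp] with x hx
    rw [hx, real_inner_self_eq_norm_sq, Real.norm_eq_abs, sq_abs]
  have e := ofTest_eq hs φ (WithLp.toLp 2 (h1.toLp, h2.toLp)) h1.coeFn_toLp h2.coeFn_toLp
  rw [show ‖ofTest hs φ‖ = ‖(ofTest hs φ : PairSpace)‖ from rfl, e, WithLp.prod_norm_sq_eq_of_L2]
  simp only [WithLp.toLp_fst, WithLp.toLp_snd]
  rw [key, key]
  rfl

theorem denseRange_ofTest : DenseRange (ofTest hs) := by
  intro u
  rw [Metric.mem_closure_range_iff]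
  intro ε hε
  have hu := u.2
  rw [← SetLike.mem_coe, Submodule.topologicalClosure_coe, Metric.mem_closure_iff] at hu
  obtain ⟨p, ⟨φ, h1, h2⟩, hp⟩ := hu ε hε
  refine ⟨φ, ?_⟩
  rw [Subtype.dist_eq, ofTest_eq hs φ p h1 h2]
  exact hp

/-- An operator from test functions to functions on `(0,1]` that is linear pointwise and bounded from
the `H^s` norm to the norm of `L²(0,1)`. -/
structure IsBddOp (s : ℝ) (T : Test → ℝ → ℝ) : Prop where
  add : ∀ φ ψ, ∀ x ∈ Ioc (0 : ℝ) 1, T (φ + ψ) x = T φ x + T ψ x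
  smul : ∀ (k : ℝ) φ, ∀ x ∈ Ioc (0 : ℝ) 1, T (k • φ) x = k * T φ x
  memLp : ∀ φ, MemLp (T φ) 2 (volume.restrict (Ioc (0 : ℝ) 1))
  bound : ∃ C, ∀ φ, ∫ x in Ioc (0 : ℝ) 1, T φ x ^ 2 ≤ C * ((∫ x, φ x ^ 2) + semi s φ)

/-- The extension of a bounded operator to `H^s_0(Ω)`. -/
theorem IsBddOp.exists_clm {T : Test → ℝ → ℝ} (hT : IsBddOp s T) :
    ∃ A : H0 s →L[ℝ] Lp ℝ 2 (volume.restrict (Ioc (0 : ℝ) 1)),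
      ∀ φ, A (ofTest hs φ) = (hT.memLp φ).toLp (T φ) := by
  let f : Test →ₗ[ℝ] Lp ℝ 2 (volume.restrict (Ioc (0 : ℝ) 1)) :=
    { toFun := fun φ => (hT.memLp φ).toLp (T φ)
      map_add' := fun φ ψ => by
        rw [← MemLp.toLp_add, MemLp.toLp_eq_toLp_iff]
        filter_upwards [ae_restrict_mem measurableSet_Ioc] with x hx
        exact hT.add φ ψ x hx
      map_smul' := fun c φ => by
        rw [RingHom.id_apply, ← MemLp.toLp_const_smul, MemLp.toLp_eq_toLp_iff]
        filter_upwards [ae_restrict_mem measurableSet_Ioc] with x hx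
        exact hT.smul c φ x hx }
  obtain ⟨C, hC⟩ := hT.bound
  refine ⟨f.extendOfNorm (ofTest hs), fun φ =>
    LinearMap.extendOfNorm_eq (denseRange_ofTest hs) ⟨Real.sqrt (max C 0), fun φ => ?_⟩ φ⟩
  refine le_of_sq_le_sq ?_ (by positivity)
  rw [mul_pow, Real.sq_sqrt (le_max_right _ _), norm_ofTest_sq]
  have h1 : ‖f φ‖ ^ 2 = ∫ x in Ioc (0 : ℝ) 1, T φ x ^ 2 := by
    rw [← real_inner_self_eq_norm_sq, L2.inner_def]
    refine integral_congr_ae ?_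
    filter_upwards [(hT.memLp φ).coeFn_toLp] with x hx
    change inner ℝ ((hT.memLp φ).toLp (T φ) x) ((hT.memLp φ).toLp (T φ) x) = _
    rw [hx, real_inner_self_eq_norm_sq, Real.norm_eq_abs, sq_abs]
  rw [h1]
  refine (hC φ).trans (mul_le_mul_of_nonneg_right (le_max_left _ _) ?_)
  exact add_nonneg (integral_nonneg fun _ => sq_nonneg _) (semi_nonneg _ _)

/-- The `L²(0,1)` product of two bounded operators defines a continuous bilinear form on
`H^s_0(Ω)`. -/
theorem IsBddOp.isInduced {T S : Test → ℝ → ℝ} (hT : IsBddOp s T) (hS : IsBddOp s S) :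
    IsInduced (ofTest hs) (fun φ ψ => ∫ x in (0 : ℝ)..1, T φ x * S ψ x) := by
  obtain ⟨A, hA⟩ := hT.exists_clm hs
  obtain ⟨B, hB⟩ := hS.exists_clm hs
  refine ⟨(innerSL ℝ).bilinearComp A B, fun φ ψ => ?_⟩
  simp only
  rw [ContinuousLinearMap.bilinearComp_apply, innerSL_apply_apply, hA, hB, L2.inner_def,
    intervalIntegral.integral_of_le zero_le_one]
  refine integral_congr_ae ?_
  filter_upwards [(hT.memLp φ).coeFn_toLp, (hS.memLp ψ).coeFn_toLp] with x h1 h2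
  rw [h1, h2]
  exact mul_comm _ _
end

/-! ### Power kernels and products of fractional integrals -/

/-- The integral operator `∫_0^x κ(x-t) q(t) dt`. -/
noncomputable def convL (κ q : ℝ → ℝ) (x : ℝ) : ℝ := ∫ t in (0 : ℝ)..x, κ (x - t) * q t

/-- The integral operator `∫_x^1 κ(t-x) q(t) dt`. -/
noncomputable def convR (κ q : ℝ → ℝ) (x : ℝ) : ℝ := ∫ t in x..(1 : ℝ), κ (t - x) * q t

theorem convR_eq_convL (κ q : ℝ → ℝ) (x : ℝ) :
    convR κ q x = convL κ (fun t => q (1 - t)) (1 - x) := by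
  unfold convR convL
  have h := intervalIntegral.integral_comp_sub_left (fun t => κ (t - x) * q t) (1 : ℝ)
    (a := 0) (b := 1 - x)
  rw [sub_sub_cancel, sub_zero] at h
  rw [← h]
  refine intervalIntegral.integral_congr fun t _ => ?_
  simp only [show 1 - t - x = 1 - x - t by ring]

/-- The homogeneous kernel `z_+^(-a)`. -/
noncomputable def powPos (a : ℝ) : ℝ → ℝ := (Ioi 0).indicator fun z => z ^ (-a)

theorem powPos_of_pos {a z : ℝ} (hz : 0 < z) : powPos a z = z ^ (-a) := indicator_of_mem hz _

theorem powPos_of_nonpos {a z : ℝ} (hz : z ≤ 0) : powPos a z = 0 :=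
  indicator_of_notMem (not_lt.2 hz) _

theorem powPos_nonneg (a z : ℝ) : 0 ≤ powPos a z :=
  indicator_nonneg (fun _ hz => Real.rpow_nonneg (le_of_lt hz) _) _

@[fun_prop]
theorem measurable_powPos (a : ℝ) : Measurable (powPos a) :=
  Measurable.indicator (by fun_prop) measurableSet_Ioi

theorem powPos_mul {c : ℝ} (hc : 0 < c) (a z : ℝ) : powPos a (c * z) = c ^ (-a) * powPos a z := by
  rcases lt_or_ge 0 z with hz | hz
  · rw [powPos_of_pos hz, powPos_of_pos (mul_pos hc hz), Real.mul_rpow hc.le hz.le]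
  · rw [powPos_of_nonpos hz, powPos_of_nonpos (mul_nonpos_of_nonneg_of_nonpos hc.le hz), mul_zero]

theorem integrableOn_powPos {a : ℝ} (ha : a < 1) (c : ℝ) : IntegrableOn (powPos a) (Iic c) := by
  have h0 : IntegrableOn (powPos a) (Iic 0) :=
    (integrableOn_zero (ε' := ℝ)).congr_fun (fun z hz => (powPos_of_nonpos hz).symm) measurableSet_Iic
  rcases le_total c 0 with hc | hc
  · exact h0.mono_set (Iic_subset_Iic.2 hc)
  rw [← Iic_union_Ioc_eq_Iic hc]
  refine h0.union ?_
  refine ((intervalIntegrable_iff_integrableOn_Ioc_of_le hc).1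
    (intervalIntegral.intervalIntegrable_rpow' (r := -a) (by linarith))).congr_fun
    (fun z hz => (powPos_of_pos hz.1).symm) measurableSet_Ioc

theorem integrable_powPos_mul_powPos {γ δ : ℝ} (hγ : γ ∈ Ioo (0 : ℝ) 1) (hδ : δ ∈ Ioo (0 : ℝ) 1) :
    Integrable fun y => powPos γ y * powPos δ (1 - y) := by
  have h1 : IntegrableOn (powPos γ) (Icc 0 1) := (integrableOn_powPos hγ.2 1).mono_set Icc_subset_Iic_self
  have h2 : IntegrableOn (fun y => powPos δ (1 - y)) (Icc 0 1) := by
    have := (integrableOn_powPos hδ.2 1).mono_set (Icc_subset_Iic_self (a := (0 : ℝ)))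
    rw [← intervalIntegrable_iff_integrableOn_Icc_of_le zero_le_one] at this ⊢
    simpa using (this.comp_sub_left 1).symm
  have h3 := IntegrableOn.integrable_indicator ((h1.const_mul (2 ^ δ)).add (h2.const_mul (2 ^ γ)))
    measurableSet_Icc
  refine h3.mono' (by fun_prop) (Filter.Eventually.of_forall fun y => ?_)
  rw [Real.norm_of_nonneg (mul_nonneg (powPos_nonneg _ _) (powPos_nonneg _ _))]
  by_cases hy : y ∈ Icc (0 : ℝ) 1
  · rw [indicator_of_mem hy]
    have key : ∀ {a z : ℝ}, 0 < a → 1 / 2 ≤ z → powPos a z ≤ 2 ^ a := by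
      intro a z ha hz
      rw [powPos_of_pos (by linarith), Real.rpow_neg (by linarith), ← Real.inv_rpow (by linarith)]
      refine Real.rpow_le_rpow (by positivity) ?_ ha.le
      rw [inv_le_comm₀ (by linarith) two_pos]
      linarith
    have p1 := powPos_nonneg γ y
    have p2 := powPos_nonneg δ (1 - y)
    have q1 : (0 : ℝ) ≤ 2 ^ γ := by positivity
    have q2 : (0 : ℝ) ≤ 2 ^ δ := by positivity
    simp only [Pi.add_apply]
    rcases le_total (1 / 2) y with h | h
    · nlinarith [key hγ.1 h, mul_nonneg q2 p1]
    · nlinarith [key hδ.1 (show 1 / 2 ≤ 1 - y by linarith), mul_nonneg q1 p2]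
  · rw [indicator_of_notMem hy]
    rcases le_total y 0 with h | h
    · rw [powPos_of_nonpos h, zero_mul]
    · have : 1 - y ≤ 0 := by
        by_contra hc
        exact hy ⟨h, by linarith⟩
      rw [powPos_of_nonpos this, mul_zero]

theorem integrable_powPos_mul_powPos_add {β : ℝ} (hβ : β ∈ Ioo (1 / 2 : ℝ) 1) :
    Integrable fun y => powPos β (y + 1) * powPos β y := by
  have h1 : IntegrableOn (fun y => powPos β (y + 1) * powPos β y) (Iic 1) := by
    refine (integrableOn_powPos hβ.2 1).mono' (by fun_prop) (Filter.Eventually.of_forall fun y => ?_)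
    rw [Real.norm_of_nonneg (mul_nonneg (powPos_nonneg _ _) (powPos_nonneg _ _))]
    rcases le_or_gt y 0 with h | h
    · simp [powPos_of_nonpos h]
    · refine mul_le_of_le_one_left (powPos_nonneg _ _) ?_
      rw [powPos_of_pos (by linarith)]
      exact Real.rpow_le_one_of_one_le_of_nonpos (by linarith) (by linarith [hβ.1])
  have h2 : IntegrableOn (fun y => powPos β (y + 1) * powPos β y) (Ioi 1) := by
    refine (integrableOn_Ioi_rpow_of_lt (a := -(2 * β)) (by linarith [hβ.1]) one_pos).mono'
      (by fun_prop) ?_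
    filter_upwards [ae_restrict_mem measurableSet_Ioi] with y hy
    have h0 : 0 < y := zero_lt_one.trans hy
    rw [Real.norm_of_nonneg (mul_nonneg (powPos_nonneg _ _) (powPos_nonneg _ _)),
      show -(2 * β) = -β + -β by ring, Real.rpow_add h0, powPos_of_pos h0, powPos_of_pos (by linarith)]
    refine mul_le_mul_of_nonneg_right ?_ (by positivity)
    exact Real.rpow_le_rpow_of_nonpos h0 (by linarith) (by linarith [hβ.1])
  rw [← integrableOn_univ, ← Iic_union_Ioi (a := (1 : ℝ))]
  exact h1.union h2

/-- Scaling computes the integral of a product of two power kernels. -/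
theorem integral_powPos_left_right {γ δ t τ : ℝ} (h : t ≠ τ) :
    ∫ x, powPos γ (x - t) * powPos δ (τ - x) =
      (∫ y, powPos γ y * powPos δ (1 - y)) * powPos (γ + δ - 1) (τ - t) := by
  rcases lt_or_gt_of_ne h with h | h
  · have hc : 0 < τ - t := sub_pos.2 h
    have e1 : ∫ x, powPos γ (x - t) * powPos δ (τ - x) =
        ∫ x, powPos γ x * powPos δ ((τ - t) - x) := by
      rw [← integral_add_right_eq_self _ t]
      refine integral_congr_ae (Filter.Eventually.of_forall fun x => ?_)
      simp only [add_sub_cancel_right, show τ - (x + t) = τ - t - x by ring]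
    have e2 := Measure.integral_comp_mul_left
      (fun x => powPos γ x * powPos δ ((τ - t) - x)) (τ - t)
    have e3 : ∀ y, powPos γ ((τ - t) * y) * powPos δ ((τ - t) - (τ - t) * y) =
        ((τ - t) ^ (-γ) * (τ - t) ^ (-δ)) * (powPos γ y * powPos δ (1 - y)) := by
      intro y
      rw [show (τ - t) - (τ - t) * y = (τ - t) * (1 - y) by ring, powPos_mul hc, powPos_mul hc]
      ring
    simp only [e3, integral_const_mul, smul_eq_mul] at e2
    rw [abs_of_pos (inv_pos.2 hc), eq_inv_mul_iff_mul_eq₀ hc.ne'] at e2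
    rw [e1, ← e2, powPos_of_pos hc, show -(γ + δ - 1) = 1 + (-γ + -δ) by ring, Real.rpow_add hc,
      Real.rpow_add hc, Real.rpow_one]
    ring
  · rw [powPos_of_nonpos (by linarith), mul_zero]
    refine integral_eq_zero_of_ae (Filter.Eventually.of_forall fun x => ?_)
    rcases le_total x t with hx | hx
    · simp [powPos_of_nonpos (show x - t ≤ 0 by linarith)]
    · simp [powPos_of_nonpos (show τ - x ≤ 0 by linarith)]

theorem integrable_powPos_left_right {γ δ t τ : ℝ} (hγ : γ ∈ Ioo (0 : ℝ) 1)
    (hδ : δ ∈ Ioo (0 : ℝ) 1) (h : t ≠ τ) :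
    Integrable fun x => powPos γ (x - t) * powPos δ (τ - x) := by
  rcases lt_or_gt_of_ne h with h | h
  · have hc : 0 < τ - t := sub_pos.2 h
    have h1 := ((integrable_powPos_mul_powPos hγ hδ).comp_mul_left' (inv_pos.2 hc).ne').comp_sub_right t
    refine (h1.const_mul ((τ - t) ^ (-γ) * (τ - t) ^ (-δ))).congr
      (Filter.Eventually.of_forall fun x => ?_)
    have e1 : x - t = (τ - t) * ((τ - t)⁻¹ * (x - t)) := by field_simp
    have e2 : τ - x = (τ - t) * (1 - (τ - t)⁻¹ * (x - t)) := by field_simp; ring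
    simp only
    conv_rhs => rw [e1, e2, powPos_mul hc, powPos_mul hc]
    ring
  · refine (integrable_zero ℝ ℝ volume).congr (Filter.Eventually.of_forall fun x => ?_)
    rcases le_total x t with hx | hx
    · simp [powPos_of_nonpos (show x - t ≤ 0 by linarith)]
    · simp [powPos_of_nonpos (show τ - x ≤ 0 by linarith)]

theorem integral_powPos_left_left {β t τ : ℝ} (h : t ≠ τ) :
    ∫ x, powPos β (x - t) * powPos β (x - τ) =
      (∫ y, powPos β (y + 1) * powPos β y) * |t - τ| ^ (1 - 2 * β) := by
  wlog hlt : t < τ generalizing t τ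
  · rw [abs_sub_comm, ← this h.symm (lt_of_le_of_ne (not_lt.1 hlt) h.symm)]
    simp only [mul_comm]
  have hc : 0 < τ - t := sub_pos.2 hlt
  have e1 : ∫ x, powPos β (x - t) * powPos β (x - τ) =
      ∫ x, powPos β (x + (τ - t)) * powPos β x := by
    rw [← integral_add_right_eq_self _ τ]
    refine integral_congr_ae (Filter.Eventually.of_forall fun x => ?_)
    simp only [add_sub_cancel_right, show x + τ - t = x + (τ - t) by ring]
  have e2 := Measure.integral_comp_mul_left
    (fun x => powPos β (x + (τ - t)) * powPos β x) (τ - t)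
  have e3 : ∀ y, powPos β ((τ - t) * y + (τ - t)) * powPos β ((τ - t) * y) =
      ((τ - t) ^ (-β) * (τ - t) ^ (-β)) * (powPos β (y + 1) * powPos β y) := by
    intro y
    rw [show (τ - t) * y + (τ - t) = (τ - t) * (y + 1) by ring, powPos_mul hc, powPos_mul hc]
    ring
  simp only [e3, integral_const_mul, smul_eq_mul] at e2
  rw [abs_of_pos (inv_pos.2 hc), eq_inv_mul_iff_mul_eq₀ hc.ne'] at e2
  rw [e1, ← e2, abs_sub_comm, abs_of_pos hc, show 1 - 2 * β = 1 + (-β + -β) by ring,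
    Real.rpow_add hc, Real.rpow_add hc, Real.rpow_one]
  ring

theorem integrable_powPos_left_left {β t τ : ℝ} (hβ : β ∈ Ioo (1 / 2 : ℝ) 1) (h : t ≠ τ) :
    Integrable fun x => powPos β (x - t) * powPos β (x - τ) := by
  wlog hlt : t < τ generalizing t τ
  · simpa only [mul_comm] using this h.symm (lt_of_le_of_ne (not_lt.1 hlt) h.symm)
  have hc : 0 < τ - t := sub_pos.2 hlt
  have h1 := ((integrable_powPos_mul_powPos_add hβ).comp_mul_left' (inv_pos.2 hc).ne').comp_sub_right τ
  refine (h1.const_mul ((τ - t) ^ (-β) * (τ - t) ^ (-β))).congr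
    (Filter.Eventually.of_forall fun x => ?_)
  have e1 : x - τ = (τ - t) * ((τ - t)⁻¹ * (x - τ)) := by field_simp
  have e2 : x - t = (τ - t) * ((τ - t)⁻¹ * (x - τ) + 1) := by field_simp; ring
  simp only
  conv_rhs => rw [e1, e2, powPos_mul hc, powPos_mul hc]
  ring

theorem integrable_kernel_prod {R f g : ℝ → ℝ} (hR : IntegrableOn R (Icc (-1) 1))
    (hf : Continuous f) (hg : Continuous g) (hf0 : ∀ x ∉ Ioo (0 : ℝ) 1, f x = 0)
    (hg0 : ∀ x ∉ Ioo (0 : ℝ) 1, g x = 0) :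
    Integrable fun p : ℝ × ℝ => R (p.1 - p.2) * (f p.1 * g p.2) := by
  have cs : ∀ {f : ℝ → ℝ}, (∀ x ∉ Ioo (0 : ℝ) 1, f x = 0) → HasCompactSupport f := fun h =>
    HasCompactSupport.intro isCompact_Icc fun x hx => h x fun h' => hx (Ioo_subset_Icc_self h')
  have h1 := (hg.integrable_of_hasCompactSupport (cs hg0) (μ := volume)).convolution_integrand
    (ContinuousLinearMap.mul ℝ ℝ) (hR.integrable_indicator measurableSet_Icc)
  obtain ⟨M, hM⟩ := hf.bounded_above_of_compact_support (cs hf0)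
  have h2 := h1.bdd_mul (f := fun p : ℝ × ℝ => f p.1) (c := M) (by fun_prop)
    (Filter.Eventually.of_forall fun p => hM p.1)
  refine h2.congr (Filter.Eventually.of_forall fun p => ?_)
  simp only [ContinuousLinearMap.mul_apply']
  by_cases h3 : p.1 ∈ Ioo (0 : ℝ) 1
  · by_cases h4 : p.2 ∈ Ioo (0 : ℝ) 1
    · have h5 : p.1 - p.2 ∈ Icc (-1 : ℝ) 1 :=
        ⟨by linarith [h3.1, h4.2], by linarith [h3.2, h4.1]⟩
      rw [indicator_of_mem h5]
      ring
    · simp [hg0 _ h4]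
  · simp [hf0 _ h3]

theorem ae_fst_ne_snd : ∀ᵐ p : ℝ × ℝ, p.1 ≠ p.2 := by
  rw [Measure.volume_eq_prod]
  refine Measure.ae_prod_iff_ae_ae (measurableSet_eq_fun measurable_fst measurable_snd).compl |>.2 ?_
  refine Filter.Eventually.of_forall fun x => ?_
  filter_upwards [compl_mem_ae_iff.2 (measure_singleton x)] with y hy h
  exact hy h.symm

/-- The integral of the product of two convolutions, as a double integral. -/
theorem integral_conv_mul_conv {P Q R f g : ℝ → ℝ} (hP : Measurable P) (hQ : Measurable Q)
    (hP0 : ∀ z, 0 ≤ P z) (hQ0 : ∀ z, 0 ≤ Q z)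
    (hPQ : ∀ t τ, t ≠ τ → Integrable fun x => P (x - t) * Q (x - τ))
    (hPQR : ∀ t τ, t ≠ τ → ∫ x, P (x - t) * Q (x - τ) = R (t - τ))
    (hR : IntegrableOn R (Icc (-1) 1))
    (hf : Continuous f) (hg : Continuous g) (hf0 : ∀ x ∉ Ioo (0 : ℝ) 1, f x = 0)
    (hg0 : ∀ x ∉ Ioo (0 : ℝ) 1, g x = 0) :
    Integrable (fun x => (∫ t, P (x - t) * f t) * ∫ t, Q (x - t) * g t) ∧
    ∫ x, (∫ t, P (x - t) * f t) * (∫ t, Q (x - t) * g t) =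
      ∫ p : ℝ × ℝ, R (p.1 - p.2) * (f p.1 * g p.2) := by
  set F : (ℝ × ℝ) → ℝ → ℝ := fun p x => (P (x - p.1) * Q (x - p.2)) * (f p.1 * g p.2) with hF
  have hFm : Measurable (Function.uncurry F) := by
    simp only [hF, Function.uncurry_def]; fun_prop
  have hFi : Integrable (Function.uncurry F) ((volume : Measure (ℝ × ℝ)).prod volume) := by
    rw [integrable_prod_iff hFm.aestronglyMeasurable]
    refine ⟨?_, ?_⟩
    · filter_upwards [ae_fst_ne_snd] with p hp
      exact (hPQ _ _ hp).mul_const (f p.1 * g p.2)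
    · refine (integrable_kernel_prod hR hf hg hf0 hg0).norm.congr ?_
      filter_upwards [ae_fst_ne_snd] with p hp
      simp only [hF, Function.uncurry, norm_mul (P _ * Q _), integral_mul_const]
      rw [norm_mul, ← hPQR _ _ hp]
      congr 1
      have h0 : ∀ x, 0 ≤ P (x - p.1) * Q (x - p.2) := fun x => mul_nonneg (hP0 _) (hQ0 _)
      rw [Real.norm_of_nonneg (integral_nonneg h0)]
      exact integral_congr_ae (Filter.Eventually.of_forall fun x => (Real.norm_of_nonneg (h0 x)).symm)
  have hprod : ∀ x, ∫ p, F p x = (∫ t, P (x - t) * f t) * ∫ t, Q (x - t) * g t := by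
    intro x
    rw [Measure.volume_eq_prod, ← integral_prod_mul]
    refine integral_congr_ae (Filter.Eventually.of_forall fun p => ?_)
    simp only [hF]; ring
  constructor
  · simpa only [Function.uncurry, hprod] using hFi.integral_prod_right
  · simp only [← hprod]
    rw [← integral_integral_swap hFi]
    refine integral_congr_ae ?_
    filter_upwards [ae_fst_ne_snd] with p hp
    simp only [hF, integral_mul_const, hPQR _ _ hp]

theorem convL_rpow_eq {a x : ℝ} {q : ℝ → ℝ} (hq : ∀ x ∉ Ioo (0 : ℝ) 1, q x = 0) (hx : 0 ≤ x) :
    convL (fun z => z ^ (-a)) q x = ∫ t, powPos a (x - t) * q t := by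
  unfold convL
  rw [intervalIntegral.integral_of_le hx, integral_Ioc_eq_integral_Ioo,
    ← integral_indicator measurableSet_Ioo]
  refine integral_congr_ae (Filter.Eventually.of_forall fun t => ?_)
  by_cases ht : t ∈ Ioo 0 x
  · simp only [indicator_of_mem ht]
    rw [powPos_of_pos (sub_pos.2 ht.2)]
  · simp only [indicator_of_notMem ht]
    by_cases h0 : t ∈ Ioo (0 : ℝ) 1
    · rw [powPos_of_nonpos, zero_mul]
      by_contra hc
      exact ht ⟨h0.1, by linarith⟩
    · rw [hq t h0, mul_zero]

theorem convR_rpow_eq {a x : ℝ} {q : ℝ → ℝ} (hq : ∀ x ∉ Ioo (0 : ℝ) 1, q x = 0) (hx : x ≤ 1) :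
    convR (fun z => z ^ (-a)) q x = ∫ t, powPos a (t - x) * q t := by
  rw [convR_eq_convL, convL_rpow_eq (fun t ht => hq _ fun h => ht ⟨by linarith [h.2], by linarith [h.1]⟩)
    (by linarith), ← integral_sub_left_eq_self _ volume (1 : ℝ)]
  refine integral_congr_ae (Filter.Eventually.of_forall fun t => ?_)
  simp only [sub_sub_cancel, show 1 - x - (1 - t) = t - x by ring]

/-- The product of a left-sided and a right-sided fractional integral, integrated over `(0,1)`. -/
theorem integral_convL_mul_convR {γ δ : ℝ} (hγ : γ ∈ Ioo (0 : ℝ) 1) (hδ : δ ∈ Ioo (0 : ℝ) 1) :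
    ∃ B : ℝ, 0 < B ∧ ∀ f g : ℝ → ℝ, Continuous f → Continuous g →
      (∀ x ∉ Ioo (0 : ℝ) 1, f x = 0) → (∀ x ∉ Ioo (0 : ℝ) 1, g x = 0) →
      ∫ x in (0 : ℝ)..1, convL (fun z => z ^ (-γ)) f x * convR (fun z => z ^ (-δ)) g x =
        B * ∫ p : ℝ × ℝ, powPos (γ + δ - 1) (p.2 - p.1) * (f p.1 * g p.2) := by
  refine ⟨∫ y, powPos γ y * powPos δ (1 - y), ?_, fun f g hf hg hf0 hg0 => ?_⟩
  · refine (integral_pos_iff_support_of_nonneg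
      (fun y => mul_nonneg (powPos_nonneg _ _) (powPos_nonneg _ _))
      (integrable_powPos_mul_powPos hγ hδ)).2 ?_
    refine lt_of_lt_of_le ?_ (measure_mono (s := Ioo (0 : ℝ) 1) fun y hy => ?_)
    · simp
    · have h2 : 0 < 1 - y := by linarith [hy.2]
      rw [Function.mem_support, powPos_of_pos hy.1, powPos_of_pos h2]
      exact (mul_pos (Real.rpow_pos_of_pos hy.1 _) (Real.rpow_pos_of_pos h2 _)).ne'
  · have h := (integral_conv_mul_conv (P := powPos γ) (Q := fun z => powPos δ (-z))
      (R := fun h => (∫ y, powPos γ y * powPos δ (1 - y)) * powPos (γ + δ - 1) (-h))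
      (measurable_powPos γ) (by fun_prop) (powPos_nonneg γ) (fun z => powPos_nonneg δ _)
      (fun t τ h => by simpa only [neg_sub] using integrable_powPos_left_right hγ hδ h)
      (fun t τ h => by simpa only [neg_sub] using integral_powPos_left_right h)
      (by
        refine Integrable.const_mul ?_ _
        have h1 : IntegrableOn (powPos (γ + δ - 1)) (Icc (-1) 1) :=
          (integrableOn_powPos (by linarith [hγ.2, hδ.2]) 1).mono_set Icc_subset_Iic_self
        rw [← IntegrableOn]
        simpa using h1.comp_neg) hf hg hf0 hg0).2
    simp only [neg_sub, mul_assoc, integral_const_mul] at h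
    rw [← h, intervalIntegral.integral_of_le zero_le_one, ← integral_indicator measurableSet_Ioc]
    refine integral_congr_ae (Filter.Eventually.of_forall fun x => ?_)
    by_cases hx : x ∈ Ioc (0 : ℝ) 1
    · simp only [indicator_of_mem hx]
      rw [convL_rpow_eq hf0 hx.1.le, convR_rpow_eq hg0 hx.2]
    · simp only [indicator_of_notMem hx]
      symm
      by_cases h0 : x ≤ 0
      · refine mul_eq_zero_of_left (integral_eq_zero_of_ae (Filter.Eventually.of_forall fun t => ?_)) _
        by_cases ht : t ∈ Ioo (0 : ℝ) 1
        · simp [powPos_of_nonpos (show x - t ≤ 0 by linarith [ht.1])]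
        · simp [hf0 t ht]
      · refine mul_eq_zero_of_right _ (integral_eq_zero_of_ae (Filter.Eventually.of_forall fun t => ?_))
        by_cases ht : t ∈ Ioo (0 : ℝ) 1
        · have : ¬ x ≤ 1 := fun h1 => hx ⟨by linarith, h1⟩
          simp [powPos_of_nonpos (show t - x ≤ 0 by linarith [ht.2])]
        · simp [hg0 t ht]

theorem integrableOn_abs_rpow {a : ℝ} (ha : a < 1) : IntegrableOn (fun h : ℝ => |h| ^ (-a)) (Icc (-1) 1) := by
  have h1 : IntegrableOn (powPos a) (Icc (-1) 1) :=
    (integrableOn_powPos ha 1).mono_set Icc_subset_Iic_self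
  have h2 : IntegrableOn (fun z => powPos a (-z)) (Icc (-1) 1) := by
    have := h1.comp_neg
    simpa using this
  refine (h1.add h2).congr ?_
  filter_upwards [ae_restrict_of_ae (compl_mem_ae_iff.2 (measure_singleton (0 : ℝ)))] with z hz
  rcases lt_or_gt_of_ne (show z ≠ 0 from hz) with h | h
  · simp [powPos_of_nonpos h.le, powPos_of_pos (neg_pos.2 h), abs_of_neg h]
  · simp [powPos_of_nonpos (neg_nonpos.2 h.le), powPos_of_pos h, abs_of_pos h]

/-- The square of a left-sided fractional integral, integrated over `(0,1)`. -/
theorem integral_convL_sq_le {β : ℝ} (hβ : β ∈ Ioo (1 / 2 : ℝ) 1) :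
    ∃ c : ℝ, 0 ≤ c ∧ ∀ f : ℝ → ℝ, Continuous f → (∀ x ∉ Ioo (0 : ℝ) 1, f x = 0) →
      IntegrableOn (fun x => convL (fun z => z ^ (-β)) f x ^ 2) (Ioc 0 1) ∧
      ∫ x in Ioc (0 : ℝ) 1, convL (fun z => z ^ (-β)) f x ^ 2 ≤
        c * ∫ p : ℝ × ℝ, |p.1 - p.2| ^ (1 - 2 * β) * (f p.1 * f p.2) := by
  refine ⟨∫ y, powPos β (y + 1) * powPos β y,
    integral_nonneg fun y => mul_nonneg (powPos_nonneg _ _) (powPos_nonneg _ _),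
    fun f hf hf0 => ?_⟩
  obtain ⟨h1, h2⟩ := integral_conv_mul_conv (P := powPos β) (Q := powPos β)
      (R := fun h => (∫ y, powPos β (y + 1) * powPos β y) * |h| ^ (1 - 2 * β))
      (measurable_powPos β) (measurable_powPos β) (powPos_nonneg β) (powPos_nonneg β)
      (fun t τ h => integrable_powPos_left_left hβ h)
      (fun t τ h => integral_powPos_left_left h)
      (by
        refine Integrable.const_mul ?_ _
        have := integrableOn_abs_rpow (a := 2 * β - 1) (by linarith [hβ.2])
        rwa [neg_sub] at this) hf hf hf0 hf0
  have e : EqOn (fun x => convL (fun z => z ^ (-β)) f x ^ 2)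
      (fun x => (∫ t, powPos β (x - t) * f t) * ∫ t, powPos β (x - t) * f t) (Ioc 0 1) :=
    fun x hx => by simp only; rw [convL_rpow_eq hf0 hx.1.le, sq]
  simp only [mul_assoc, integral_const_mul] at h2
  refine ⟨h1.integrableOn.congr_fun e.symm measurableSet_Ioc, ?_⟩
  rw [← h2, setIntegral_congr_fun measurableSet_Ioc e]
  exact setIntegral_le_integral h1 (Filter.Eventually.of_forall fun x => mul_self_nonneg _)

/-! ### The energy identity -/

/-- The correlation `∫ g(t) f(t + h) dt`. -/
noncomputable def corr (g f : ℝ → ℝ) (h : ℝ) : ℝ := ∫ t, g t * f (t + h)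

theorem corr_neg (g f : ℝ → ℝ) (h : ℝ) : corr g f (-h) = corr f g h := by
  unfold corr
  rw [← integral_add_right_eq_self _ h]
  refine integral_congr_ae (Filter.Eventually.of_forall fun t => ?_)
  simp only [add_neg_cancel_right, mul_comm]

theorem hasCompactSupport_of_zero_off {f : ℝ → ℝ} (hf0 : ∀ x ∉ Ioo (0 : ℝ) 1, f x = 0) :
    HasCompactSupport f :=
  HasCompactSupport.intro isCompact_Icc fun x hx => hf0 x fun h => hx (Ioo_subset_Icc_self h)

theorem exists_bound_corr {g f : ℝ → ℝ} (hf : Continuous f) (hg : Continuous g)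
    (hf0 : ∀ x ∉ Ioo (0 : ℝ) 1, f x = 0) (hg0 : ∀ x ∉ Ioo (0 : ℝ) 1, g x = 0) :
    ∃ M, 0 ≤ M ∧ ∀ h, |corr g f h| ≤ M := by
  obtain ⟨K, hK⟩ := hf.bounded_above_of_compact_support (hasCompactSupport_of_zero_off hf0)
  have hK0 : 0 ≤ K := (norm_nonneg _).trans (hK 0)
  have hgi := hg.integrable_of_hasCompactSupport (hasCompactSupport_of_zero_off hg0) (μ := volume)
  refine ⟨∫ t, K * |g t|, integral_nonneg fun t => mul_nonneg hK0 (abs_nonneg _), fun h => ?_⟩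
  refine norm_integral_le_of_norm_le (f := fun t => g t * f (t + h)) (hgi.abs.const_mul K) (Filter.Eventually.of_forall fun t => ?_)
  rw [norm_mul, mul_comm]
  exact mul_le_mul_of_nonneg_right (hK _) (norm_nonneg _)

theorem hasDerivAt_corr {g f : ℝ → ℝ} (hf : IsC1Zero f) (hg : Continuous g)
    (hg0 : ∀ x ∉ Ioo (0 : ℝ) 1, g x = 0) (h : ℝ) :
    HasDerivAt (corr g f) (corr g (deriv f) h) h := by
  obtain ⟨K, hK0, hK⟩ := hf.exists_bound_deriv
  have hgc := hasCompactSupport_of_zero_off hg0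
  have hgi := hg.integrable_of_hasCompactSupport hgc (μ := volume)
  have hfc := hf.continuous
  have hfd := hf.continuous_deriv
  refine (hasDerivAt_integral_of_dominated_loc_of_deriv_le (F := fun h t => g t * f (t + h))
    (F' := fun h t => g t * deriv f (t + h)) (bound := fun t => K * |g t|) (s := univ)
    Filter.univ_mem ?_ ?_ ?_ ?_ ?_ ?_).2
  · exact Filter.Eventually.of_forall fun x => by fun_prop
  · exact Continuous.integrable_of_hasCompactSupport (by fun_prop) hgc.mul_right
  · fun_prop
  · refine Filter.Eventually.of_forall fun t x _ => ?_
    rw [norm_mul, mul_comm]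
    exact mul_le_mul_of_nonneg_right (hK _) (norm_nonneg _)
  · exact hgi.abs.const_mul K
  · exact Filter.Eventually.of_forall fun t x _ =>
      ((hf.hasDerivAt (t + x)).comp_const_add t x).const_mul (g t)

theorem corr_eq_zero {g f : ℝ → ℝ} (hf0 : ∀ x ∉ Ioo (0 : ℝ) 1, f x = 0)
    (hg0 : ∀ x ∉ Ioo (0 : ℝ) 1, g x = 0) {h : ℝ} (hh : 1 ≤ h) : corr g f h = 0 := by
  refine integral_eq_zero_of_ae (Filter.Eventually.of_forall fun t => ?_)
  by_cases ht : t ∈ Ioo (0 : ℝ) 1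
  · have : t + h ∉ Ioo (0 : ℝ) 1 := fun h' => by linarith [h'.2, ht.1]
    simp [hf0 _ this]
  · simp [hg0 _ ht]

/-- Integration over the plane along the diagonals. -/
theorem integral_diagonal {F : ℝ × ℝ → ℝ} (hF : Integrable F) :
    Integrable (fun h => ∫ t, F (t, t + h)) ∧ ∫ p, F p = ∫ h, ∫ t, F (t, t + h) := by
  have hm : MeasurePreserving (fun z : ℝ × ℝ => (z.1, z.1 + z.2)) volume volume :=
    measurePreserving_prod_add volume volume
  have he : MeasurableEmbedding (fun z : ℝ × ℝ => (z.1, z.1 + z.2)) :=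
    (MeasurableEquiv.shearAddRight ℝ).measurableEmbedding
  have hi : Integrable (fun z : ℝ × ℝ => F (z.1, z.1 + z.2)) := (hm.integrable_comp_emb he).2 hF
  rw [Measure.volume_eq_prod] at hi
  refine ⟨hi.integral_prod_right, ?_⟩
  rw [← hm.integral_comp he, Measure.volume_eq_prod, integral_prod_symm _ hi]

section
variable {u : ℝ → ℝ} (hu : IsC1Zero u)
include hu

theorem integral_sq_shift (h : ℝ) : ∫ t, (u t - u (t + h)) ^ 2 = 2 * corr u u 0 - 2 * corr u u h := by
  have hc := hu.continuous
  have cs := hu.hasCompactSupport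
  have i1 : Integrable fun t => u t * u t :=
    Continuous.integrable_of_hasCompactSupport (by fun_prop) cs.mul_right
  have i2 : Integrable fun t => u t * u (t + h) :=
    Continuous.integrable_of_hasCompactSupport (by fun_prop) cs.mul_right
  have i3 : Integrable fun t => u (t + h) * u (t + h) := i1.comp_add_right h
  have e3 : ∫ t, u (t + h) * u (t + h) = ∫ t, u t * u t :=
    integral_add_right_eq_self (fun t => u t * u t) h
  have e : (fun t => (u t - u (t + h)) ^ 2) =
      fun t => (u t * u t + u (t + h) * u (t + h)) - 2 * (u t * u (t + h)) := by
    ext t; ring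
  unfold corr
  have i4 : Integrable fun t => u t * u t + u (t + h) * u (t + h) := i1.add i3
  rw [e, integral_sub i4 (i2.const_mul 2), integral_add i1 i3, e3, integral_const_mul]
  simp only [add_zero]
  ring

theorem hasDerivAt_corr_deriv (h : ℝ) :
    HasDerivAt (corr u (deriv u)) (-corr (deriv u) (deriv u) h) h := by
  have h1 : HasDerivAt (fun x => corr (deriv u) u (-x)) (corr (deriv u) (deriv u) (-h) * -1) h :=
    (hasDerivAt_corr hu hu.continuous_deriv (fun x hx => hu.deriv_zero_off hx) (-h)).comp h
      (hasDerivAt_neg h)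
  simp only [corr_neg] at h1
  rwa [mul_neg_one] at h1

/-- The growth near zero of the squared shift norm `ψ(h) = ‖u - u(· + h)‖²` and of its derivative. -/
theorem exists_shift_bounds : ∃ M, 0 ≤ M ∧ ∀ h, 0 ≤ h →
    |-2 * corr u (deriv u) h| ≤ M * h ∧ |2 * corr u u 0 - 2 * corr u u h| ≤ M * h * h := by
  have hd0 := fun x hx => hu.deriv_zero_off (x := x) hx
  obtain ⟨M, hM0, hM⟩ := exists_bound_corr hu.continuous_deriv hu.continuous_deriv hd0 hd0
  have h1 : ∀ h, HasDerivAt (fun h => 2 * corr u u 0 - 2 * corr u u h) (-2 * corr u (deriv u) h) h := by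
    intro h
    simpa using ((hasDerivAt_corr hu hu.continuous hu.zero_off h).const_mul 2).const_sub (2 * corr u u 0)
  have h2 : ∀ h, HasDerivAt (fun h => -2 * corr u (deriv u) h)
      (2 * corr (deriv u) (deriv u) h) h := by
    intro h
    exact ((hasDerivAt_corr_deriv hu h).const_mul (-2)).congr_deriv (by ring)
  have h0 : -2 * corr u (deriv u) 0 = 0 := by
    refine IsLocalMin.hasDerivAt_eq_zero (f := fun h => 2 * corr u u 0 - 2 * corr u u h)
      (Filter.Eventually.of_forall fun h => ?_) (h1 0)
    simp only [sub_self]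
    rw [← integral_sq_shift hu]
    exact integral_nonneg fun _ => sq_nonneg _
  have b1 : ∀ h, 0 ≤ h → |-2 * corr u (deriv u) h| ≤ 2 * M * h := by
    intro h hh
    have := Convex.norm_image_sub_le_of_norm_hasDerivWithin_le (C := 2 * M)
      (fun z _ => (h2 z).hasDerivWithinAt) (fun z _ => by
        rw [norm_mul, Real.norm_eq_abs, Real.norm_eq_abs, abs_two]
        exact mul_le_mul_of_nonneg_left (hM z) two_pos.le) convex_univ
      (mem_univ 0) (mem_univ h)
    rw [h0, sub_zero, sub_zero, Real.norm_of_nonneg hh] at this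
    exact this
  refine ⟨2 * M, by positivity, fun h hh => ⟨b1 h hh, ?_⟩⟩
  have := Convex.norm_image_sub_le_of_norm_hasDerivWithin_le (C := 2 * M * h) (s := Icc 0 h)
    (fun z _ => (h1 z).hasDerivWithinAt) (fun z hz => by
      rw [Real.norm_eq_abs]
      refine (b1 z hz.1).trans (mul_le_mul_of_nonneg_left hz.2 (by positivity))) (convex_Icc _ _)
      (left_mem_Icc.2 hh) (right_mem_Icc.2 hh)
  rw [sub_self, sub_zero, sub_zero, Real.norm_of_nonneg hh] at this
  exact this

omit hu in
theorem diffQuot_sq (s : ℝ) (v : ℝ → ℝ) (t h : ℝ) :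
    diffQuot s v (t, t + h) ^ 2 = |h| ^ (-(1 + 2 * s)) * (v t - v (t + h)) ^ 2 := by
  simp only [diffQuot, div_pow, sub_add_cancel_left, abs_neg]
  rw [Real.rpow_neg (abs_nonneg _), ← Real.rpow_natCast (|h| ^ (1 / 2 + s)),
    ← Real.rpow_mul (abs_nonneg _), div_eq_inv_mul]
  congr 3
  push_cast; ring

open Filter Topology in
/-- The energy identity: two integrations by parts in the increment `h` turn the quadratic form with
kernel `h_+^(1-2β)` in `u'` into the Sobolev-Slobodeckij seminorm of order `β` of `u`. -/
theorem integral_energy {β : ℝ} (hβ : β ∈ Ioo (1 / 2 : ℝ) 1)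
    (hq : Integrable fun p => diffQuot β u p ^ 2) :
    ∫ p : ℝ × ℝ, powPos (2 * β - 1) (p.2 - p.1) * (deriv u p.1 * deriv u p.2) =
      β * (2 * β - 1) / 2 * semi β u := by
  have hb1 := hβ.1
  have hb2 := hβ.2
  have hd0 := fun x hx => hu.deriv_zero_off (x := x) hx
  set ψ : ℝ → ℝ := fun h => 2 * corr u u 0 - 2 * corr u u h with hψ
  set ψ1 : ℝ → ℝ := fun h => -2 * corr u (deriv u) h with hψ1
  set ψ2 : ℝ → ℝ := fun h => 2 * corr (deriv u) (deriv u) h with hψ2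
  -- both sides as integrals over the increment
  have k1 : IntegrableOn (fun h => powPos (2 * β - 1) (-h)) (Icc (-1) 1) := by
    have h1 : IntegrableOn (powPos (2 * β - 1)) (Icc (-1) 1) :=
      (integrableOn_powPos (by linarith) 1).mono_set Icc_subset_Iic_self
    simpa using h1.comp_neg
  have k2 := integrable_kernel_prod k1 hu.continuous_deriv hu.continuous_deriv hd0 hd0
  simp only [neg_sub] at k2
  obtain ⟨k3, k4⟩ := integral_diagonal k2
  have k5 : ∀ h : ℝ, ∫ t, powPos (2 * β - 1) (t + h - t) * (deriv u t * deriv u (t + h)) =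
      powPos (2 * β - 1) h * (ψ2 h / 2) := by
    intro h
    simp only [add_sub_cancel_left, integral_const_mul, hψ2, corr]
    ring
  simp only [k5] at k3 k4
  obtain ⟨l1, l2⟩ := integral_diagonal hq
  have l3 : ∀ h : ℝ, ∫ t, diffQuot β u (t, t + h) ^ 2 = |h| ^ (-(1 + 2 * β)) * ψ h := by
    intro h
    simp only [diffQuot_sq, integral_const_mul, integral_sq_shift hu, hψ]
  simp only [l3] at l1 l2
  have l4 : ∫ h, |h| ^ (-(1 + 2 * β)) * ψ h = 2 * ∫ h in Ioi 0, h ^ (-(1 + 2 * β)) * ψ h := by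
    rw [← integral_comp_abs (f := fun h => h ^ (-(1 + 2 * β)) * ψ h)]
    refine integral_congr_ae (Eventually.of_forall fun h => ?_)
    simp only [hψ]
    rcases le_total 0 h with h0 | h0
    · rw [abs_of_nonneg h0]
    · rw [abs_of_nonpos h0, corr_neg]
  have k6 : ∫ h, powPos (2 * β - 1) h * (ψ2 h / 2) = (∫ h in Ioi 0, h ^ (1 - 2 * β) * ψ2 h) / 2 := by
    rw [← integral_div, ← integral_indicator measurableSet_Ioi]
    refine integral_congr_ae (Eventually.of_forall fun h => ?_)
    simp only
    rcases lt_or_ge 0 h with h0 | h0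
    · rw [indicator_of_mem (mem_Ioi.2 h0), powPos_of_pos h0, neg_sub]; ring
    · rw [indicator_of_notMem (notMem_Ioi.2 h0), powPos_of_nonpos h0, zero_mul]
  have i1 : IntegrableOn (fun h => h ^ (1 - 2 * β) * ψ2 h) (Ioi 0) := by
    refine IntegrableOn.congr_fun (k3.integrableOn.const_mul 2) (fun h hh => ?_) measurableSet_Ioi
    rw [powPos_of_pos hh, neg_sub]; ring
  have i2 : IntegrableOn (fun h => h ^ (-(1 + 2 * β)) * ψ h) (Ioi 0) := by
    refine l1.integrableOn.congr_fun (fun h hh => ?_) measurableSet_Ioi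
    simp only
    rw [abs_of_pos hh]
  -- a primitive of the difference of the two integrands, vanishing at `0` and at infinity
  set F : ℝ → ℝ := fun h => h ^ (1 - 2 * β) * ψ1 h + (2 * β - 1) * (h ^ (-(2 * β)) * ψ h) with hF
  obtain ⟨M, hM0, hM⟩ := exists_shift_bounds hu
  have d1 : ∀ h, HasDerivAt ψ (ψ1 h) h := by
    intro h
    simpa [hψ, hψ1] using
      ((hasDerivAt_corr hu hu.continuous hu.zero_off h).const_mul 2).const_sub (2 * corr u u 0)
  have d2 : ∀ h, HasDerivAt ψ1 (ψ2 h) h := by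
    intro h
    exact ((hasDerivAt_corr_deriv hu h).const_mul (-2)).congr_deriv (by ring)
  have dF : ∀ h ∈ Ioi (0 : ℝ), HasDerivAt F
      (h ^ (1 - 2 * β) * ψ2 h - 2 * β * (2 * β - 1) * (h ^ (-(1 + 2 * β)) * ψ h)) h := by
    intro h hh
    have p1 := (Real.hasDerivAt_rpow_const (p := 1 - 2 * β) (Or.inl (ne_of_gt hh))).mul (d2 h)
    have p2 := ((Real.hasDerivAt_rpow_const (p := -(2 * β)) (Or.inl (ne_of_gt hh))).mul
      (d1 h)).const_mul (2 * β - 1)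
    refine (p1.add p2).congr_deriv ?_
    rw [show 1 - 2 * β - 1 = -(2 * β) by ring, show -(2 * β) - 1 = -(1 + 2 * β) by ring]
    ring
  have F0 : F 0 = 0 := by
    simp only [hF, Real.zero_rpow (show 1 - 2 * β ≠ 0 by linarith),
      Real.zero_rpow (show -(2 * β) ≠ 0 by linarith)]
    ring
  have bF : ∀ h ∈ Ici (0 : ℝ), ‖F h‖ ≤ 2 * β * M * h ^ (2 - 2 * β) := by
    intro h hh
    rcases eq_or_lt_of_le (show (0 : ℝ) ≤ h from hh) with h0 | h0
    · rw [← h0, F0, norm_zero]; positivity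
    obtain ⟨m1, m2⟩ := hM h h0.le
    have r1 : h ^ (2 - 2 * β) = h ^ (1 - 2 * β) * h := by
      rw [← Real.rpow_add_one h0.ne']; congr 1; ring
    have r2 : h ^ (2 - 2 * β) = h ^ (-(2 * β)) * (h * h) := by
      rw [← mul_assoc, ← Real.rpow_add_one h0.ne', ← Real.rpow_add_one h0.ne']; congr 1; ring
    have q1 : 0 ≤ h ^ (1 - 2 * β) := by positivity
    have q2 : 0 ≤ h ^ (-(2 * β)) := by positivity
    calc ‖F h‖ ≤ h ^ (1 - 2 * β) * |ψ1 h| + (2 * β - 1) * (h ^ (-(2 * β)) * |ψ h|) := by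
          refine (norm_add_le _ _).trans (le_of_eq ?_)
          rw [norm_mul _ (ψ1 h), norm_mul _ (_ * ψ h), norm_mul _ (ψ h), Real.norm_of_nonneg q1, Real.norm_of_nonneg q2,
            Real.norm_of_nonneg (show 0 ≤ 2 * β - 1 by linarith)]
          rfl
      _ ≤ h ^ (1 - 2 * β) * (M * h) + (2 * β - 1) * (h ^ (-(2 * β)) * (M * h * h)) :=
          add_le_add (mul_le_mul_of_nonneg_left m1 q1) (mul_le_mul_of_nonneg_left
            (mul_le_mul_of_nonneg_left m2 q2) (by linarith))
      _ = 2 * β * M * h ^ (2 - 2 * β) := by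
          rw [show M * h * h = M * (h * h) by ring, mul_left_comm _ M, mul_left_comm _ M, ← r1, ← r2]
          ring
  have cF : ContinuousWithinAt F (Ici 0) 0 := by
    rw [ContinuousWithinAt, F0]
    refine squeeze_zero_norm' (eventually_nhdsWithin_of_forall bF) ?_
    have : Tendsto (fun h : ℝ => 2 * β * M * h ^ (2 - 2 * β)) (𝓝 0) (𝓝 (2 * β * M * 0 ^ (2 - 2 * β))) :=
      ((Real.continuousAt_rpow_const 0 (2 - 2 * β) (Or.inr (by linarith))).tendsto).const_mul _
    rw [Real.zero_rpow (by linarith), mul_zero] at this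
    exact this.mono_left nhdsWithin_le_nhds
  have tF : Tendsto F atTop (𝓝 0) := by
    have h1 : Tendsto (fun h : ℝ => (2 * β - 1) * (h ^ (-(2 * β)) * (2 * corr u u 0))) atTop
        (𝓝 ((2 * β - 1) * (0 * (2 * corr u u 0)))) :=
      ((tendsto_rpow_neg_atTop (by linarith)).mul_const _).const_mul _
    rw [zero_mul, mul_zero] at h1
    refine h1.congr' ?_
    filter_upwards [eventually_ge_atTop 1] with h hh
    simp only [hF, hψ, hψ1, corr_eq_zero hu.zero_off hu.zero_off hh, corr_eq_zero hd0 hu.zero_off hh]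
    ring
  have main := integral_Ioi_of_hasDerivAt_of_tendsto cF dF (i1.sub (i2.const_mul _)) tF
  rw [integral_sub i1 (i2.const_mul _), integral_const_mul, F0] at main
  unfold semi
  rw [k4, k6, l2, l4]
  linarith

theorem integral_energy_abs {β : ℝ} (hβ : β ∈ Ioo (1 / 2 : ℝ) 1)
    (hq : Integrable fun p => diffQuot β u p ^ 2) :
    ∫ p : ℝ × ℝ, |p.1 - p.2| ^ (1 - 2 * β) * (deriv u p.1 * deriv u p.2) =
      β * (2 * β - 1) * semi β u := by
  have hd0 := fun x hx => hu.deriv_zero_off (x := x) hx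
  have h1 : IntegrableOn (powPos (2 * β - 1)) (Icc (-1) 1) :=
    (integrableOn_powPos (by linarith [hβ.2]) 1).mono_set Icc_subset_Iic_self
  have h2 : IntegrableOn (fun h => powPos (2 * β - 1) (-h)) (Icc (-1) 1) := by
    simpa using h1.comp_neg
  have k1 := integrable_kernel_prod h1 hu.continuous_deriv hu.continuous_deriv hd0 hd0
  have k2 := integrable_kernel_prod h2 hu.continuous_deriv hu.continuous_deriv hd0 hd0
  have e1 := integral_energy hu hβ hq
  have e2 : ∫ p : ℝ × ℝ, powPos (2 * β - 1) (p.1 - p.2) * (deriv u p.1 * deriv u p.2) =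
      β * (2 * β - 1) / 2 * semi β u := by
    rw [← e1, Measure.volume_eq_prod, ← integral_prod_swap]
    refine integral_congr_ae (Filter.Eventually.of_forall fun p => ?_)
    simp only [Prod.fst_swap, Prod.snd_swap, mul_comm (deriv u p.2)]
  simp only [neg_sub] at k2
  rw [show β * (2 * β - 1) * semi β u = β * (2 * β - 1) / 2 * semi β u
    + β * (2 * β - 1) / 2 * semi β u by ring]
  conv_rhs => rw [← e1]
  rw [← e1] at e2
  conv_rhs => enter [1]; rw [← e2]
  rw [← integral_add k1 k2]
  refine integral_congr_ae ?_
  filter_upwards [ae_fst_ne_snd] with p hp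
  rw [← add_mul]
  congr 1
  rcases lt_or_gt_of_ne hp with h | h
  · rw [powPos_of_nonpos (by linarith), powPos_of_pos (by linarith), zero_add, neg_sub,
      abs_of_neg (by linarith), neg_sub]
  · rw [powPos_of_pos (by linarith), powPos_of_nonpos (by linarith), add_zero, neg_sub,
      abs_of_pos (by linarith)]
end

/-! ### Fractional derivatives of lower order -/

/-- The Cauchy-Schwarz inequality for integrals. -/
theorem sq_integral_mul_le {X : Type*} [MeasurableSpace X] {μ : Measure X} {f g : X → ℝ}
    (hf : MemLp f 2 μ) (hg : MemLp g 2 μ) :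
    (∫ x, f x * g x ∂μ) ^ 2 ≤ (∫ x, f x ^ 2 ∂μ) * ∫ x, g x ^ 2 ∂μ := by
  have key : ∀ {f g : X → ℝ} (hf : MemLp f 2 μ) (hg : MemLp g 2 μ),
      inner ℝ (hg.toLp g) (hf.toLp f) = ∫ x, f x * g x ∂μ := by
    intro f g hf hg
    rw [L2.inner_def]
    refine integral_congr_ae ?_
    filter_upwards [hf.coeFn_toLp, hg.coeFn_toLp] with x h1 h2
    rw [h1, h2]; rfl
  have := real_inner_mul_inner_self_le (hg.toLp g) (hf.toLp f)
  rw [key hf hg, key hg hg, key hf hf] at this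
  simp only [← sq] at this
  rwa [mul_comm (∫ x, f x ^ 2 ∂μ)]

theorem stronglyMeasurable_convL {κ q : ℝ → ℝ} (hκ : Measurable κ) (hq : Continuous q) :
    AEStronglyMeasurable (convL κ q) (volume.restrict (Ioc (0 : ℝ) 1)) := by
  have h1 : StronglyMeasurable fun x : ℝ =>
      ∫ t, {p : ℝ × ℝ | 0 < p.2 ∧ p.2 ≤ p.1}.indicator (fun p => κ (p.1 - p.2) * q p.2) (x, t) := by
    refine StronglyMeasurable.integral_prod_right' ?_
    refine StronglyMeasurable.indicator ?_ ?_
    · exact Measurable.stronglyMeasurable (by fun_prop)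
    · exact (measurableSet_lt measurable_const measurable_snd).inter
        (measurableSet_le measurable_snd measurable_fst)
  refine h1.aestronglyMeasurable.congr ?_
  filter_upwards [ae_restrict_mem measurableSet_Ioc] with x hx
  unfold convL
  rw [intervalIntegral.integral_of_le hx.1.le, ← integral_indicator measurableSet_Ioc]
  rfl

theorem intervalIntegrable_kernel {κ q : ℝ → ℝ} {C σ x : ℝ} (hκ : Measurable κ) (hσ : σ < 1)
    (hb : ∀ z ∈ Ioo (0 : ℝ) 1, |κ z| ≤ C * z ^ (-σ)) (hq : Continuous q) (hx : x ∈ Ioc (0 : ℝ) 1) :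
    IntervalIntegrable (fun t => κ (x - t) * q t) volume 0 x := by
  refine IntervalIntegrable.mul_continuousOn ?_ hq.continuousOn
  have h1 : IntervalIntegrable (fun z : ℝ => C * z ^ (-σ)) volume 0 x :=
    (intervalIntegral.intervalIntegrable_rpow' (by linarith)).const_mul C
  have h2 : IntervalIntegrable (fun t : ℝ => C * (x - t) ^ (-σ)) volume 0 x := by
    simpa using (h1.comp_sub_left x).symm
  rw [intervalIntegrable_iff_integrableOn_Ioo_of_le hx.1.le] at h2 ⊢
  refine Integrable.mono' h2 (hκ.comp (measurable_const.sub measurable_id)).aestronglyMeasurable ?_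
  filter_upwards [ae_restrict_mem measurableSet_Ioo] with t ht
  exact hb _ ⟨by linarith [ht.2], by linarith [ht.1, hx.2]⟩

theorem diffQuot_sq_eq (s : ℝ) (v : ℝ → ℝ) (x y : ℝ) :
    diffQuot s v (x, y) ^ 2 = |x - y| ^ (-(1 + 2 * s)) * (v x - v y) ^ 2 := by
  have := diffQuot_sq s v x (y - x)
  rwa [add_sub_cancel, abs_sub_comm] at this

section
variable {s : ℝ} {w : ℝ → ℝ} {x : ℝ}

/-- A pointwise Hardy inequality: the increments of `w` between `x` and the points to the left of
`0`, where `w` vanishes, control `w(x)`. -/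
theorem sq_mul_rpow_le (hs : s ∈ Ioo (0 : ℝ) 1) (hw : IsC1Zero w) (hx : x ∈ Ioo (0 : ℝ) 1)
    (hN : Integrable fun y => diffQuot s w (x, y) ^ 2) :
    w x ^ 2 * x ^ (-(2 * s)) ≤ 8 * ∫ y, diffQuot s w (x, y) ^ 2 := by
  have h0 := hx.1
  have h1 : ∫ y in Ioc (-x) 0, (2 * x) ^ (-(1 + 2 * s)) * w x ^ 2 ≤
      ∫ y in Ioc (-x) 0, diffQuot s w (x, y) ^ 2 := by
    refine setIntegral_mono_on (integrableOn_const (by simp)) hN.integrableOn measurableSet_Ioc fun y hy => ?_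
    rw [diffQuot_sq_eq, hw.zero_off y (fun h => absurd h.1 (not_lt.2 hy.2)), sub_zero,
      abs_of_pos (by linarith [hy.2])]
    refine mul_le_mul_of_nonneg_right ?_ (sq_nonneg _)
    exact Real.rpow_le_rpow_of_nonpos (by linarith [hy.2]) (by linarith [hy.1])
      (by linarith [hs.1])
  have h2 := h1.trans (setIntegral_le_integral hN (Filter.Eventually.of_forall fun y => sq_nonneg _))
  simp only [setIntegral_const, smul_eq_mul] at h2
  rw [measureReal_def, Real.volume_Ioc, zero_sub, neg_neg, ENNReal.toReal_ofReal h0.le,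
    Real.mul_rpow two_pos.le h0.le] at h2
  have e1 : x ^ (-(2 * s)) = x * x ^ (-(1 + 2 * s)) := by
    rw [mul_comm x, ← Real.rpow_add_one h0.ne']; congr 1; ring
  have e2 : (1 : ℝ) ≤ 8 * 2 ^ (-(1 + 2 * s)) := by
    have : (2 : ℝ) ^ (-3 : ℝ) ≤ 2 ^ (-(1 + 2 * s)) :=
      Real.rpow_le_rpow_of_exponent_le one_le_two (by linarith [hs.2])
    rw [Real.rpow_neg two_pos.le, show (3 : ℝ) = ((3 : ℕ) : ℝ) by norm_num, Real.rpow_natCast] at this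
    linarith
  have e3 : 0 ≤ w x ^ 2 * x ^ (-(2 * s)) := by positivity
  rw [e1] at e3 ⊢
  nlinarith

theorem sq_integral_increment_le {σ : ℝ} (hσ : σ < s) (hw : IsC1Zero w) (hx : x ∈ Ioo (0 : ℝ) 1)
    (hN : Integrable fun y => diffQuot s w (x, y) ^ 2) :
    (∫ t in (0 : ℝ)..x, (x - t) ^ (-σ - 1) * |w t - w x|) ^ 2 ≤
      1 / (2 * (s - σ)) * ∫ y, diffQuot s w (x, y) ^ 2 := by
  have hw' := hw.continuous.measurable
  have hi : IntervalIntegrable (fun t : ℝ => (x - t) ^ (2 * (s - σ) - 1)) volume 0 x := by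
    have h1 : IntervalIntegrable (fun z : ℝ => z ^ (2 * (s - σ) - 1)) volume 0 x :=
      intervalIntegral.intervalIntegrable_rpow' (by linarith)
    simpa using (h1.comp_sub_left x).symm
  have e1 : ∀ t ∈ Ioo 0 x, ((x - t) ^ (s - σ - 1 / 2)) ^ 2 = (x - t) ^ (2 * (s - σ) - 1) := by
    intro t ht
    rw [← Real.rpow_natCast, ← Real.rpow_mul (by linarith [ht.2])]
    congr 1; push_cast; ring
  have h1 : MemLp (fun t => (x - t) ^ (s - σ - 1 / 2)) 2 (volume.restrict (Ioo 0 x)) := by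
    have hm : Measurable fun t => (x - t) ^ (s - σ - 1 / 2) := by fun_prop
    rw [memLp_two_iff_integrable_sq hm.aestronglyMeasurable]
    rw [intervalIntegrable_iff_integrableOn_Ioo_of_le hx.1.le] at hi
    exact hi.congr_fun (fun t ht => (e1 t ht).symm) measurableSet_Ioo
  have h2 : MemLp (fun t => |diffQuot s w (x, t)|) 2 (volume.restrict (Ioo 0 x)) := by
    have hm : Measurable fun t => |diffQuot s w (x, t)| := by unfold diffQuot; fun_prop
    rw [memLp_two_iff_integrable_sq hm.aestronglyMeasurable]
    simpa only [sq_abs] using hN.restrict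
  have h3 := sq_integral_mul_le h1 h2
  have e2 : ∫ t in (0 : ℝ)..x, (x - t) ^ (-σ - 1) * |w t - w x| =
      ∫ t in Ioo 0 x, (x - t) ^ (s - σ - 1 / 2) * |diffQuot s w (x, t)| := by
    rw [intervalIntegral.integral_of_le hx.1.le, integral_Ioc_eq_integral_Ioo]
    refine setIntegral_congr_fun measurableSet_Ioo fun t ht => ?_
    have h0 : 0 < x - t := by linarith [ht.2]
    simp only [diffQuot, abs_div, abs_of_pos h0, abs_of_pos (Real.rpow_pos_of_pos h0 _)]
    rw [abs_sub_comm (w x), mul_div_assoc', mul_comm (_ ^ (s - σ - 1 / 2)), mul_div_assoc,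
      ← Real.rpow_sub h0, mul_comm]
    congr 2; ring
  have e3 : ∫ t in Ioo 0 x, ((x - t) ^ (s - σ - 1 / 2)) ^ 2 ≤ 1 / (2 * (s - σ)) := by
    rw [setIntegral_congr_fun measurableSet_Ioo e1, ← integral_Ioc_eq_integral_Ioo,
      ← intervalIntegral.integral_of_le hx.1.le,
      intervalIntegral.integral_comp_sub_left (fun z => z ^ (2 * (s - σ) - 1)) x, sub_self, sub_zero,
      integral_rpow (Or.inl (by linarith)), sub_add_cancel, Real.zero_rpow (by linarith), sub_zero]
    exact div_le_div_of_nonneg_right (Real.rpow_le_one hx.1.le hx.2.le (by linarith)) (by linarith)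
  rw [e2]
  refine h3.trans (mul_le_mul e3 ?_ (integral_nonneg fun _ => sq_nonneg _)
    (div_nonneg zero_le_one (by linarith)))
  simp only [sq_abs]
  exact setIntegral_le_integral hN (Filter.Eventually.of_forall fun y => sq_nonneg _)

open Filter Topology in
/-- Integration by parts moves the derivative from `w` to the kernel. -/
theorem abs_convL_deriv_le {κ : ℝ → ℝ} {C σ : ℝ} (hκ : Measurable κ) (hσ : σ < 1)
    (hd : ∀ z ∈ Ioo (0 : ℝ) 1, DifferentiableAt ℝ κ z)
    (hb : ∀ z ∈ Ioo (0 : ℝ) 1, |κ z| ≤ C * z ^ (-σ))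
    (hb' : ∀ z ∈ Ioo (0 : ℝ) 1, |deriv κ z| ≤ C * z ^ (-σ - 1))
    (hw : IsC1Zero w) (hx : x ∈ Ioo (0 : ℝ) 1) :
    |convL κ (deriv w) x| ≤
      C * (x ^ (-σ) * |w x| + ∫ t in (0 : ℝ)..x, (x - t) ^ (-σ - 1) * |w t - w x|) := by
  obtain ⟨K, hK0, hK⟩ := hw.exists_bound_deriv
  have hwm := hw.continuous.measurable
  have hC : 0 ≤ C := by
    have h1 := (abs_nonneg _).trans (hb x hx)
    exact nonneg_of_mul_nonneg_left h1 (Real.rpow_pos_of_pos hx.1 _)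
  have mem : ∀ t ∈ Ioo 0 x, x - t ∈ Ioo (0 : ℝ) 1 := fun t ht =>
    ⟨by linarith [ht.2], by linarith [ht.1, hx.2]⟩
  have i0 : IntervalIntegrable (fun t : ℝ => (x - t) ^ (-σ)) volume 0 x := by
    have h1 : IntervalIntegrable (fun z : ℝ => z ^ (-σ)) volume 0 x :=
      intervalIntegral.intervalIntegrable_rpow' (by linarith)
    simpa using (h1.comp_sub_left x).symm
  have pt : ∀ t ∈ Ioo 0 x, (x - t) ^ (-σ - 1) * |w t - w x| ≤ K * (x - t) ^ (-σ) := by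
    intro t ht
    have h0 := (mem t ht).1
    have h1 := hw.abs_sub_le hK t x
    rw [abs_sub_comm t, abs_of_pos h0] at h1
    calc (x - t) ^ (-σ - 1) * |w t - w x| ≤ (x - t) ^ (-σ - 1) * (K * (x - t)) :=
          mul_le_mul_of_nonneg_left h1 (by positivity)
      _ = K * (x - t) ^ (-σ) := by
          rw [mul_left_comm, ← Real.rpow_add_one h0.ne', sub_add_cancel]
  have i1 : IntervalIntegrable (fun t => (x - t) ^ (-σ - 1) * |w t - w x|) volume 0 x := by
    rw [intervalIntegrable_iff_integrableOn_Ioo_of_le hx.1.le] at i0 ⊢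
    refine (i0.const_mul K).mono' (by fun_prop) ?_
    filter_upwards [ae_restrict_mem measurableSet_Ioo] with t ht
    rw [Real.norm_of_nonneg (mul_nonneg (Real.rpow_nonneg (mem t ht).1.le _) (abs_nonneg _))]
    exact pt t ht
  have pt2 : ∀ t ∈ Ioo 0 x, |deriv κ (x - t) * (w t - w x)| ≤
      C * ((x - t) ^ (-σ - 1) * |w t - w x|) := by
    intro t ht
    rw [abs_mul, ← mul_assoc]
    exact mul_le_mul_of_nonneg_right (hb' _ (mem t ht)) (abs_nonneg _)
  have i2 : IntervalIntegrable (fun t => deriv κ (x - t) * (w t - w x)) volume 0 x := by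
    have hm : Measurable fun t => deriv κ (x - t) * (w t - w x) := by
      have := measurable_deriv κ
      fun_prop
    rw [intervalIntegrable_iff_integrableOn_Ioo_of_le hx.1.le] at i1 ⊢
    refine (i1.const_mul C).mono' hm.aestronglyMeasurable ?_
    filter_upwards [ae_restrict_mem measurableSet_Ioo] with t ht
    exact pt2 t ht
  have i3 := intervalIntegrable_kernel hκ hσ hb hw.continuous_deriv (Ioo_subset_Ioc_self hx)
  have parts := intervalIntegral.integral_eq_sub_of_hasDerivAt_of_tendsto hx.1
    (f := fun t => κ (x - t) * (w t - w x))
    (f' := fun t => κ (x - t) * deriv w t - deriv κ (x - t) * (w t - w x))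
    (fa := κ x * (0 - w x)) (fb := 0) (fun t ht => ?_) (i3.sub i2) ?_ ?_
  · rw [intervalIntegral.integral_sub i3 i2] at parts
    have e : convL κ (deriv w) x = κ x * w x + ∫ t in (0 : ℝ)..x, deriv κ (x - t) * (w t - w x) := by
      unfold convL; linarith
    rw [e, mul_add, ← mul_assoc]
    refine (abs_add_le _ _).trans (add_le_add ?_ ?_)
    · rw [abs_mul]
      exact mul_le_mul_of_nonneg_right (hb x hx) (abs_nonneg _)
    · rw [← intervalIntegral.integral_const_mul]
      refine intervalIntegral.norm_integral_le_of_norm_le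
        (f := fun t => deriv κ (x - t) * (w t - w x)) hx.1.le ?_ (i1.const_mul C)
      filter_upwards [compl_mem_ae_iff.2 (measure_singleton x)] with t h1 ht
      exact pt2 t ⟨ht.1, lt_of_le_of_ne ht.2 h1⟩
  · have h1 : HasDerivAt (fun t => κ (x - t)) (deriv κ (x - t) * -1) t :=
      (hd _ (mem t ht)).hasDerivAt.comp t ((hasDerivAt_id t).const_sub x)
    exact (h1.mul ((hw.hasDerivAt t).sub_const (w x))).congr_deriv (by ring)
  · have h1 : ContinuousAt (fun t => κ (x - t) * (w t - w x)) 0 := by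
      have h2 : ContinuousAt κ (x - 0) := by rw [sub_zero]; exact (hd x hx).continuousAt
      have h3 : ContinuousAt (fun t => κ (x - t)) 0 :=
        ContinuousAt.comp (f := fun t => x - t) h2 (by fun_prop)
      exact h3.mul (hw.continuous.continuousAt.sub continuousAt_const)
    have h2 := h1.tendsto
    rw [sub_zero, hw.zero_off 0 (by simp)] at h2
    exact h2.mono_left nhdsWithin_le_nhds
  · refine squeeze_zero_norm' (a := fun t => C * K * (x - t) ^ (1 - σ)) ?_ ?_
    · filter_upwards [Ioo_mem_nhdsLT hx.1] with t ht
      have h0 := (mem t ht).1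
      have h1 := hw.abs_sub_le hK t x
      rw [abs_sub_comm t, abs_of_pos h0] at h1
      rw [norm_mul, show 1 - σ = -σ + 1 by ring, Real.rpow_add_one h0.ne']
      calc |κ (x - t)| * |w t - w x| ≤ (C * (x - t) ^ (-σ)) * (K * (x - t)) :=
            mul_le_mul (hb _ (mem t ht)) h1 (abs_nonneg _) (by positivity)
        _ = _ := by ring
    · have h1 : ContinuousAt (fun t : ℝ => C * K * (x - t) ^ (1 - σ)) x :=
        ContinuousAt.mul continuousAt_const
          (ContinuousAt.rpow_const (by fun_prop) (Or.inr (by linarith)))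
      have h2 := h1.tendsto
      rw [sub_self, Real.zero_rpow (by linarith), mul_zero] at h2
      exact h2.mono_left nhdsWithin_le_nhds

end

/-- Convolution of `w'` with a kernel that is less singular than `z^(-s)` is bounded from
`H^s` to `L²(0,1)`. -/
theorem exists_bound_convL {s σ C : ℝ} {κ : ℝ → ℝ} (hs : s ∈ Ioo (0 : ℝ) 1) (hσ : σ < s)
    (hκ : Measurable κ) (hd : ∀ z ∈ Ioo (0 : ℝ) 1, DifferentiableAt ℝ κ z)
    (hb : ∀ z ∈ Ioo (0 : ℝ) 1, |κ z| ≤ C * z ^ (-σ))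
    (hb' : ∀ z ∈ Ioo (0 : ℝ) 1, |deriv κ z| ≤ C * z ^ (-σ - 1)) :
    ∃ D, 0 ≤ D ∧ ∀ w, IsC1Zero w → Integrable (fun p => diffQuot s w p ^ 2) →
      MemLp (convL κ (deriv w)) 2 (volume.restrict (Ioc (0 : ℝ) 1)) ∧
      ∫ x in Ioc (0 : ℝ) 1, convL κ (deriv w) x ^ 2 ≤ D * semi s w := by
  have hsσ : 0 < 1 / (2 * (s - σ)) := div_pos one_pos (by linarith)
  refine ⟨C ^ 2 * (2 * (8 + 1 / (2 * (s - σ)))), by positivity, fun w hw hq => ?_⟩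
  have hm := stronglyMeasurable_convL hκ hw.continuous_deriv
  set N : ℝ → ℝ := fun x => ∫ y, diffQuot s w (x, y) ^ 2 with hN
  have hq' := hq
  rw [Measure.volume_eq_prod] at hq'
  have hNi : Integrable N := hq'.integral_prod_left
  have hN0 : ∀ x, 0 ≤ N x := fun x => integral_nonneg fun _ => sq_nonneg _
  have pt : ∀ᵐ x ∂(volume.restrict (Ioc (0 : ℝ) 1)),
      convL κ (deriv w) x ^ 2 ≤ C ^ 2 * (2 * (8 + 1 / (2 * (s - σ)))) * N x := by
    rw [← restrict_Ioo_eq_restrict_Ioc]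
    filter_upwards [ae_restrict_of_ae hq'.prod_right_ae, ae_restrict_mem measurableSet_Ioo] with x hNx hx
    have h1 := abs_convL_deriv_le hκ (hσ.trans hs.2) hd hb hb' hw hx
    have h2 := sq_mul_rpow_le hs hw hx hNx
    have h3 := sq_integral_increment_le hσ hw hx hNx
    set A := ∫ t in (0 : ℝ)..x, (x - t) ^ (-σ - 1) * |w t - w x|
    have h4 : (x ^ (-σ) * |w x|) ^ 2 ≤ 8 * N x := by
      refine le_trans ?_ h2
      rw [mul_pow, sq_abs, mul_comm, ← Real.rpow_natCast (x ^ (-σ)), ← Real.rpow_mul hx.1.le]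
      refine mul_le_mul_of_nonneg_left ?_ (sq_nonneg _)
      refine Real.rpow_le_rpow_of_exponent_ge hx.1 hx.2.le ?_
      push_cast; linarith
    rw [← sq_abs]
    calc |convL κ (deriv w) x| ^ 2 ≤ (C * (x ^ (-σ) * |w x| + A)) ^ 2 :=
          pow_le_pow_left₀ (abs_nonneg _) h1 2
      _ ≤ C ^ 2 * (2 * ((x ^ (-σ) * |w x|) ^ 2 + A ^ 2)) := by
          rw [mul_pow]
          exact mul_le_mul_of_nonneg_left (add_sq_le) (sq_nonneg _)
      _ ≤ C ^ 2 * (2 * (8 * N x + 1 / (2 * (s - σ)) * N x)) := by gcongr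
      _ = _ := by ring
  have hi : Integrable (fun x => convL κ (deriv w) x ^ 2) (volume.restrict (Ioc (0 : ℝ) 1)) := by
    refine ((hNi.const_mul (C ^ 2 * (2 * (8 + 1 / (2 * (s - σ)))))).restrict).mono' (hm.pow 2) ?_
    filter_upwards [pt] with x hx
    rwa [Real.norm_of_nonneg (sq_nonneg _)]
  refine ⟨(memLp_two_iff_integrable_sq hm).2 hi, ?_⟩
  refine (integral_mono_ae hi (hNi.const_mul _).restrict pt).trans ?_
  refine (setIntegral_le_integral (hNi.const_mul _)
    (Filter.Eventually.of_forall fun x => mul_nonneg (by positivity) (hN0 x))).trans (le_of_eq ?_)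
  rw [integral_const_mul, semi, Measure.volume_eq_prod, integral_prod _ hq']

theorem measurePreserving_reflect :
    MeasurePreserving (fun x : ℝ => 1 - x) (volume.restrict (Ioc (0 : ℝ) 1))
      (volume.restrict (Ioc (0 : ℝ) 1)) := by
  have h := (Measure.measurePreserving_sub_left (volume : Measure ℝ) 1).restrict_preimage
    (s := Ioc (0 : ℝ) 1) measurableSet_Ioc
  have e : (fun x : ℝ => 1 - x) ⁻¹' Ioc 0 1 = Ico 0 1 := by simp
  rwa [e, restrict_Ico_eq_restrict_Ioc] at h

theorem integrable_diffQuot_reflect {s : ℝ} {u : ℝ → ℝ} (h : Integrable fun p => diffQuot s u p ^ 2) :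
    Integrable fun p => diffQuot s (fun x => u (1 - x)) p ^ 2 := by
  have h1 : MeasurePreserving (fun x : ℝ => 1 - x) volume volume :=
    Measure.measurePreserving_sub_left volume 1
  have h2 : MeasurePreserving (Prod.map (fun x : ℝ => 1 - x) (fun x : ℝ => 1 - x))
      (volume : Measure (ℝ × ℝ)) volume := by
    rw [Measure.volume_eq_prod]; exact h1.prod h1
  refine (h2.integrable_comp_of_integrable h).congr (Filter.Eventually.of_forall fun p => ?_)
  simp only [diffQuot, Prod.map, Function.comp]
  rw [show (1 - p.1 - (1 - p.2)) = p.2 - p.1 by ring, abs_sub_comm p.2]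

theorem convR_deriv {κ u : ℝ → ℝ} (hu : IsC1Zero u) (x : ℝ) :
    convR κ (deriv u) x = -convL κ (deriv fun t => u (1 - t)) (1 - x) := by
  rw [convR_eq_convL]
  unfold convL
  simp only [hu.deriv_reflect, mul_neg, intervalIntegral.integral_neg, neg_neg]

/-- A square estimate for left-sided operators on `w'` carries over to right-sided ones. -/
theorem bound_convR_of_convL {s D : ℝ} {κ : ℝ → ℝ}
    (h : ∀ w, IsC1Zero w → Integrable (fun p => diffQuot s w p ^ 2) →
      MemLp (convL κ (deriv w)) 2 (volume.restrict (Ioc (0 : ℝ) 1)) ∧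
      ∫ x in Ioc (0 : ℝ) 1, convL κ (deriv w) x ^ 2 ≤ D * semi s w) {w : ℝ → ℝ} (hw : IsC1Zero w)
    (hq : Integrable (fun p => diffQuot s w p ^ 2)) :
    MemLp (convR κ (deriv w)) 2 (volume.restrict (Ioc (0 : ℝ) 1)) ∧
      ∫ x in Ioc (0 : ℝ) 1, convR κ (deriv w) x ^ 2 ≤ D * semi s w := by
  obtain ⟨h1, h2⟩ := h _ hw.reflect (integrable_diffQuot_reflect hq)
  have e : convR κ (deriv w) = fun x => -convL κ (deriv fun t => w (1 - t)) (1 - x) :=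
    funext (convR_deriv hw)
  rw [e]
  refine ⟨(h1.comp_measurePreserving measurePreserving_reflect).neg, ?_⟩
  simp only [neg_sq]
  rw [semi_reflect] at h2
  refine le_trans (le_of_eq ?_) h2
  have he : MeasurableEmbedding (fun x : ℝ => 1 - x) :=
    (MeasurableEquiv.subLeft (1 : ℝ)).measurableEmbedding
  exact measurePreserving_reflect.integral_comp he
    (fun x => convL κ (deriv fun t => w (1 - t)) x ^ 2)

/-! ### The kernel of the variable-exponent perturbation -/

/-- `f` is twice differentiable on `(0,1)`, and its derivatives of order `k ≤ 2` are bounded by a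
multiple of `x^(m-k)`. -/
def IsSymbol (m : ℝ) (f : ℝ → ℝ) : Prop :=
  ∃ f1 f2 : ℝ → ℝ, ∃ C : ℝ, ∀ x ∈ Ioo (0 : ℝ) 1,
    (HasDerivAt f (f1 x) x ∧ HasDerivAt f1 (f2 x) x) ∧
    |f x| ≤ C * x ^ m ∧ |f1 x| ≤ C * x ^ (m - 1) ∧ |f2 x| ≤ C * x ^ (m - 2)

namespace IsSymbol

variable {m n : ℝ} {f g : ℝ → ℝ}

theorem nonneg_of_abs_le {C x y m : ℝ} (hx : 0 < x) (h : |y| ≤ C * x ^ m) : 0 ≤ C :=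
  nonneg_of_mul_nonneg_left ((abs_nonneg _).trans h) (Real.rpow_pos_of_pos hx _)

theorem congr (hf : IsSymbol m f) (h : EqOn f g (Ioo 0 1)) : IsSymbol m g := by
  obtain ⟨f1, f2, C, hC⟩ := hf
  refine ⟨f1, f2, C, fun x hx => ?_⟩
  obtain ⟨⟨h1, h2⟩, h3⟩ := hC x hx
  refine ⟨⟨h1.congr_of_eventuallyEq ?_, h2⟩, ?_⟩
  · filter_upwards [isOpen_Ioo.mem_nhds hx] with y hy using (h hy).symm
  · rwa [← h hx]

theorem mono (hf : IsSymbol m f) (hmn : n ≤ m) : IsSymbol n f := by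
  obtain ⟨f1, f2, C, hC⟩ := hf
  refine ⟨f1, f2, C, fun x hx => ?_⟩
  obtain ⟨h1, h2, h3, h4⟩ := hC x hx
  have hC0 := nonneg_of_abs_le hx.1 h2
  have key : ∀ k : ℝ, C * x ^ (m - k) ≤ C * x ^ (n - k) := fun k =>
    mul_le_mul_of_nonneg_left (Real.rpow_le_rpow_of_exponent_ge hx.1 hx.2.le (by linarith)) hC0
  refine ⟨h1, h2.trans ?_, h3.trans (key 1), h4.trans (key 2)⟩
  simpa using key 0

theorem add (hf : IsSymbol m f) (hg : IsSymbol m g) : IsSymbol m (fun x => f x + g x) := by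
  obtain ⟨f1, f2, C, hC⟩ := hf
  obtain ⟨g1, g2, D, hD⟩ := hg
  refine ⟨fun x => f1 x + g1 x, fun x => f2 x + g2 x, C + D, fun x hx => ?_⟩
  obtain ⟨⟨h1, h2⟩, h3, h4, h5⟩ := hC x hx
  obtain ⟨⟨k1, k2⟩, k3, k4, k5⟩ := hD x hx
  simp only [add_mul]
  exact ⟨⟨h1.add k1, h2.add k2⟩, (abs_add_le _ _).trans (add_le_add h3 k3),
    (abs_add_le _ _).trans (add_le_add h4 k4), (abs_add_le _ _).trans (add_le_add h5 k5)⟩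

theorem mul (hf : IsSymbol m f) (hg : IsSymbol n g) : IsSymbol (m + n) (fun x => f x * g x) := by
  obtain ⟨f1, f2, C, hC⟩ := hf
  obtain ⟨g1, g2, D, hD⟩ := hg
  refine ⟨fun x => f1 x * g x + f x * g1 x,
    fun x => (f2 x * g x + f1 x * g1 x) + (f1 x * g1 x + f x * g2 x), 4 * (C * D), fun x hx => ?_⟩
  obtain ⟨⟨h1, h2⟩, h3, h4, h5⟩ := hC x hx
  obtain ⟨⟨k1, k2⟩, k3, k4, k5⟩ := hD x hx
  have hC0 := nonneg_of_abs_le hx.1 h3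
  have hD0 := nonneg_of_abs_le hx.1 k3
  have key : ∀ {a b i j k : ℝ}, |a| ≤ C * x ^ i → |b| ≤ D * x ^ j → i + j = k →
      |a * b| ≤ C * D * x ^ k := by
    intro a b i j k ha hb hk
    rw [abs_mul, ← hk, Real.rpow_add hx.1, mul_mul_mul_comm]
    exact mul_le_mul ha hb (abs_nonneg _) (mul_nonneg hC0 (Real.rpow_nonneg hx.1.le _))
  have hp : ∀ k : ℝ, 0 ≤ C * D * x ^ k := fun k =>
    mul_nonneg (mul_nonneg hC0 hD0) (Real.rpow_nonneg hx.1.le _)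
  refine ⟨⟨h1.mul k1, (h2.mul k1).add (h1.mul k2)⟩, ?_, ?_, ?_⟩
  · have := key h3 k3 rfl
    linarith [hp (m + n)]
  · have e1 := key (k := m + n - 1) h4 k3 (by ring)
    have e2 := key (k := m + n - 1) h3 k4 (by ring)
    linarith [hp (m + n - 1), abs_add_le (f1 x * g x) (f x * g1 x)]
  · have e1 := key (k := m + n - 2) h5 k3 (by ring)
    have e2 := key (k := m + n - 2) h4 k4 (by ring)
    have e3 := key (k := m + n - 2) h3 k5 (by ring)
    linarith [abs_add_le (f2 x * g x + f1 x * g1 x) (f1 x * g1 x + f x * g2 x),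
      abs_add_le (f2 x * g x) (f1 x * g1 x), abs_add_le (f1 x * g1 x) (f x * g2 x)]

theorem rpow (m : ℝ) : IsSymbol m (fun x => x ^ m) := by
  refine ⟨fun x => m * x ^ (m - 1), fun x => m * ((m - 1) * x ^ (m - 2)),
    1 + |m| + |m * (m - 1)|, fun x hx => ?_⟩
  have hp : ∀ k : ℝ, 0 ≤ x ^ k := fun k => Real.rpow_nonneg hx.1.le k
  refine ⟨⟨Real.hasDerivAt_rpow_const (Or.inl hx.1.ne'), ?_⟩, ?_, ?_, ?_⟩
  · have := (Real.hasDerivAt_rpow_const (x := x) (p := m - 1) (Or.inl hx.1.ne')).const_mul m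
    rwa [show m - 1 - 1 = m - 2 by ring] at this
  · rw [abs_of_nonneg (hp m)]
    nlinarith [hp m, abs_nonneg m, abs_nonneg (m * (m - 1))]
  · rw [abs_mul, abs_of_nonneg (hp _)]
    nlinarith [hp (m - 1), abs_nonneg m, abs_nonneg (m * (m - 1))]
  · simp only
    rw [← mul_assoc, abs_mul, abs_of_nonneg (hp _)]
    nlinarith [hp (m - 2), abs_nonneg m, abs_nonneg (m * (m - 1))]

theorem log {ε : ℝ} (hε : 0 < ε) : IsSymbol (-ε) Real.log := by
  refine ⟨fun x => x⁻¹, fun x => -(x ^ 2)⁻¹, 1 + 1 / ε, fun x hx => ?_⟩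
  have hp : ∀ k : ℝ, 0 ≤ x ^ k := fun k => Real.rpow_nonneg hx.1.le k
  have hε' : 0 < 1 / ε := by positivity
  refine ⟨⟨Real.hasDerivAt_log hx.1.ne', hasDerivAt_inv hx.1.ne'⟩, ?_, ?_, ?_⟩
  · have h := Real.abs_log_mul_self_rpow_lt x ε hx.1 hx.2.le hε
    rw [abs_mul, abs_of_nonneg (hp ε), ← lt_div_iff₀ (Real.rpow_pos_of_pos hx.1 _)] at h
    rw [Real.rpow_neg hx.1.le, ← div_eq_mul_inv]
    refine h.le.trans (div_le_div_of_nonneg_right (by linarith) (hp ε))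
  · rw [abs_of_pos (inv_pos.2 hx.1), ← Real.rpow_neg_one]
    have : x ^ (-1 : ℝ) ≤ x ^ (-ε - 1) :=
      Real.rpow_le_rpow_of_exponent_ge hx.1 hx.2.le (by linarith)
    nlinarith [mul_nonneg hε'.le (hp (-ε - 1))]
  · rw [abs_neg, abs_of_pos (by have := hx.1; positivity), ← Real.rpow_natCast, ← Real.rpow_neg hx.1.le]
    have : x ^ (-((2 : ℕ) : ℝ)) ≤ x ^ (-ε - 2) :=
      Real.rpow_le_rpow_of_exponent_ge hx.1 hx.2.le (by push_cast; linarith)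
    exact this.trans (le_mul_of_one_le_left (hp _) (by linarith))

/-- The exponential of a symbol of nonnegative order, minus one, has the same order. -/
theorem exp_sub_one (hf : IsSymbol m f) (hm : 0 ≤ m) :
    IsSymbol m (fun x => Real.exp (f x) - 1) := by
  obtain ⟨f1, f2, C, hC⟩ := hf
  refine ⟨fun x => Real.exp (f x) * f1 x,
    fun x => Real.exp (f x) * f1 x * f1 x + Real.exp (f x) * f2 x,
    Real.exp C * (C + C * C), fun x hx => ?_⟩
  obtain ⟨⟨h1, h2⟩, h3, h4, h5⟩ := hC x hx
  have hC0 := nonneg_of_abs_le hx.1 h3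
  have hp : ∀ k : ℝ, 0 ≤ x ^ k := fun k => Real.rpow_nonneg hx.1.le k
  have hfC : |f x| ≤ C := h3.trans
    (mul_le_of_le_one_right hC0 (Real.rpow_le_one hx.1.le hx.2.le hm))
  have he : Real.exp (f x) ≤ Real.exp C := Real.exp_le_exp.2 ((le_abs_self _).trans hfC)
  have hE : 1 ≤ Real.exp C := Real.one_le_exp hC0
  have he0 := (Real.exp_pos (f x)).le
  have up : ∀ {a k : ℝ}, |a| ≤ C * x ^ k → |Real.exp (f x) * a| ≤ Real.exp C * (C * x ^ k) := by
    intro a k ha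
    rw [abs_mul, abs_of_nonneg he0]
    exact mul_le_mul he ha (abs_nonneg _) (Real.exp_pos _).le
  have extra : ∀ k : ℝ, Real.exp C * (C * x ^ k) ≤ Real.exp C * (C + C * C) * x ^ k := by
    intro k
    have : 0 ≤ Real.exp C * (C * C * x ^ k) :=
      mul_nonneg (Real.exp_pos _).le (mul_nonneg (mul_nonneg hC0 hC0) (hp k))
    linarith
  refine ⟨⟨h1.exp.sub_const 1, (h1.exp.mul h2)⟩, ?_, (up h4).trans (extra _), ?_⟩
  · refine le_trans ?_ (extra m)
    -- the mean value bound `|exp y - 1| ≤ exp |y| |y|`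
    have hexp : |Real.exp (f x) - 1| ≤ Real.exp C * |f x| := by
      have := Convex.norm_image_sub_le_of_norm_hasDerivWithin_le (f := Real.exp)
        (f' := Real.exp) (s := Iic C) (C := Real.exp C)
        (fun y _ => (Real.hasDerivAt_exp y).hasDerivWithinAt)
        (fun y hy => by
          rw [Real.norm_of_nonneg (Real.exp_pos y).le]; exact Real.exp_le_exp.2 hy)
        (convex_Iic C) (x := 0) (y := f x) hC0 ((le_abs_self _).trans hfC)
      simpa using this
    exact hexp.trans (mul_le_mul_of_nonneg_left h3 (Real.exp_pos _).le)
  · have e1 : |Real.exp (f x) * f1 x * f1 x| ≤ Real.exp C * (C * C * x ^ (m - 2)) := by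
      rw [abs_mul]
      refine (mul_le_mul (up h4) h4 (abs_nonneg _)
        (mul_nonneg (Real.exp_pos _).le (mul_nonneg hC0 (hp _)))).trans ?_
      have : x ^ (m - 1) * x ^ (m - 1) ≤ x ^ (m - 2) := by
        rw [← Real.rpow_add hx.1]
        exact Real.rpow_le_rpow_of_exponent_ge hx.1 hx.2.le (by linarith)
      calc Real.exp C * (C * x ^ (m - 1)) * (C * x ^ (m - 1))
          = Real.exp C * (C * C * (x ^ (m - 1) * x ^ (m - 1))) := by ring
        _ ≤ _ := by gcongr
    have e2 := up h5
    linarith [abs_add_le (Real.exp (f x) * f1 x * f1 x) (Real.exp (f x) * f2 x)]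

theorem of_contDiffOn_aux {p : ℝ → ℝ} (hp : ContDiffOn ℝ 2 p (Icc 0 1)) :
    ∃ p1 p2 : ℝ → ℝ, ∃ C, 0 ≤ C ∧ (∀ x ∈ Icc (0 : ℝ) 1, HasDerivWithinAt p (p1 x) (Icc 0 1) x) ∧
      (∀ x ∈ Ioo (0 : ℝ) 1, HasDerivAt p1 (p2 x) x) ∧
      ∀ x ∈ Icc (0 : ℝ) 1, |p x| ≤ C ∧ |p1 x| ≤ C ∧ |p2 x| ≤ C := by
  have hU : UniqueDiffOn ℝ (Icc (0 : ℝ) 1) := uniqueDiffOn_Icc zero_lt_one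
  have h1 : ContDiffOn ℝ 1 (derivWithin p (Icc 0 1)) (Icc 0 1) := hp.derivWithin hU (by norm_num)
  have h2 : ContinuousOn (derivWithin (derivWithin p (Icc 0 1)) (Icc 0 1)) (Icc 0 1) :=
    h1.continuousOn_derivWithin hU le_rfl
  obtain ⟨A, hA⟩ := isCompact_Icc.exists_bound_of_continuousOn hp.continuousOn
  obtain ⟨B, hB⟩ := isCompact_Icc.exists_bound_of_continuousOn h1.continuousOn
  obtain ⟨D, hD⟩ := isCompact_Icc.exists_bound_of_continuousOn h2
  have z : (0 : ℝ) ∈ Icc (0 : ℝ) 1 := by simp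
  have a0 := (norm_nonneg _).trans (hA 0 z)
  have b0 := (norm_nonneg _).trans (hB 0 z)
  have d0 := (norm_nonneg _).trans (hD 0 z)
  refine ⟨derivWithin p (Icc 0 1), derivWithin (derivWithin p (Icc 0 1)) (Icc 0 1), A + B + D,
    by positivity, fun x hx => (hp.differentiableOn (by norm_num) x hx).hasDerivWithinAt,
    fun x hx => ((h1.differentiableOn one_ne_zero x (Ioo_subset_Icc_self hx)).hasDerivWithinAt).hasDerivAt
      (Icc_mem_nhds hx.1 hx.2), fun x hx => ⟨?_, ?_, ?_⟩⟩
  · have := hA x hx; rw [Real.norm_eq_abs] at this; linarith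
  · have := hB x hx; rw [Real.norm_eq_abs] at this; linarith
  · have := hD x hx; rw [Real.norm_eq_abs] at this; linarith

theorem of_contDiffOn {p : ℝ → ℝ} (hp : ContDiffOn ℝ 2 p (Icc 0 1)) : IsSymbol 0 p := by
  obtain ⟨p1, p2, C, hC0, h1, h2, h3⟩ := of_contDiffOn_aux hp
  refine ⟨p1, p2, C, fun x hx => ?_⟩
  obtain ⟨k1, k2, k3⟩ := h3 x (Ioo_subset_Icc_self hx)
  have e : ∀ k : ℝ, k ≤ 0 → C ≤ C * x ^ k := fun k hk =>
    le_mul_of_one_le_right hC0 (Real.one_le_rpow_of_pos_of_le_one_of_nonpos hx.1 hx.2.le hk)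
  exact ⟨⟨(h1 x (Ioo_subset_Icc_self hx)).hasDerivAt (Icc_mem_nhds hx.1 hx.2), h2 x hx⟩,
    k1.trans (e _ le_rfl), k2.trans (e _ (by norm_num)), k3.trans (e _ (by norm_num))⟩

theorem sub_zero_of_contDiffOn {p : ℝ → ℝ} (hp : ContDiffOn ℝ 2 p (Icc 0 1)) :
    IsSymbol 1 (fun x => p x - p 0) := by
  obtain ⟨p1, p2, C, hC0, h1, h2, h3⟩ := of_contDiffOn_aux hp
  refine ⟨p1, p2, C, fun x hx => ?_⟩
  have hx' := Ioo_subset_Icc_self hx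
  obtain ⟨k1, k2, k3⟩ := h3 x hx'
  have e : ∀ k : ℝ, k ≤ 0 → C ≤ C * x ^ k := fun k hk =>
    le_mul_of_one_le_right hC0 (Real.one_le_rpow_of_pos_of_le_one_of_nonpos hx.1 hx.2.le hk)
  refine ⟨⟨((h1 x hx').hasDerivAt (Icc_mem_nhds hx.1 hx.2)).sub_const _, h2 x hx⟩,
    ?_, k2.trans (e _ (by norm_num)), k3.trans (e _ (by norm_num))⟩
  have := Convex.norm_image_sub_le_of_norm_hasDerivWithin_le h1 (fun y hy => (h3 y hy).2.1)
    (convex_Icc 0 1) (left_mem_Icc.2 zero_le_one) hx'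
  rw [Real.rpow_one]
  rwa [sub_zero, Real.norm_of_nonneg hx.1.le, Real.norm_eq_abs] at this

/-- The derivative of a symbol is a kernel of the next lower order. -/
theorem deriv_bounds (hf : IsSymbol m f) : ∃ C, ∀ x ∈ Ioo (0 : ℝ) 1,
    DifferentiableAt ℝ (deriv f) x ∧ |deriv f x| ≤ C * x ^ (m - 1) ∧
      |deriv (deriv f) x| ≤ C * x ^ (m - 2) := by
  obtain ⟨f1, f2, C, hC⟩ := hf
  refine ⟨C, fun x hx => ?_⟩
  obtain ⟨⟨h1, h2⟩, _, h4, h5⟩ := hC x hx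
  have h6 : HasDerivAt (deriv f) (f2 x) x := by
    refine h2.congr_of_eventuallyEq ?_
    filter_upwards [isOpen_Ioo.mem_nhds hx] with y hy using (hC y hy).1.1.deriv
  rw [h1.deriv, h6.deriv]
  exact ⟨h6.differentiableAt, h4, h5⟩

end IsSymbol

theorem contDiff_inv_Gamma : ContDiff ℝ 2 fun x : ℝ => (Real.Gamma x)⁻¹ := by
  have h : ContDiff ℂ 2 fun z : ℂ => (Complex.Gamma z)⁻¹ :=
    Complex.differentiable_one_div_Gamma.contDiff
  convert! h.real_of_complex using 2 with x
  rw [Complex.Gamma_ofReal, ← Complex.ofReal_inv, Complex.ofReal_re]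

/-- The perturbation `g_l` is less singular than the leading kernel by almost one order. -/
theorem isSymbol_gLeft {α : ℝ → ℝ} (hα : ContDiffOn ℝ 2 α (Icc 0 1)) {ε : ℝ} (hε : 0 < ε)
    (hε1 : ε ≤ 1) : IsSymbol (1 - α 0 + (1 - ε)) (gLeft α) := by
  set G : ℝ → ℝ := fun x => (Real.Gamma (2 - α x))⁻¹ with hG
  have hGc : ContDiffOn ℝ 2 G (Icc 0 1) := contDiff_inv_Gamma.comp_contDiffOn (contDiffOn_const.sub hα)
  have hy : IsSymbol (1 - ε) (fun x => (-α x - -α 0) * Real.log x) := by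
    have := (IsSymbol.sub_zero_of_contDiffOn hα.neg).mul (IsSymbol.log hε)
    rwa [← sub_eq_add_neg] at this
  have hE := hy.exp_sub_one (by linarith)
  have hR : IsSymbol (1 - ε) (fun x => (G x - G 0) +
      G x * (Real.exp ((-α x - -α 0) * Real.log x) - 1)) := by
    refine ((IsSymbol.sub_zero_of_contDiffOn hGc).mono (by linarith)).add ?_
    have := (IsSymbol.of_contDiffOn hGc).mul hE
    rwa [zero_add] at this
  refine ((IsSymbol.rpow (1 - α 0)).mul hR).congr fun x hx => ?_
  have hF : ContDiffOn ℝ 1 (fun y => x ^ (1 - α y) / Real.Gamma (2 - α y)) (Icc 0 x) := by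
    have h1 : ContDiffOn ℝ 1 (fun y => Real.exp (Real.log x * (1 - α y)) * G y) (Icc 0 1) :=
      (Real.contDiff_exp.comp_contDiffOn (contDiffOn_const.mul
        (contDiffOn_const.sub (hα.of_le (by norm_num))))).mul (hGc.of_le (by norm_num))
    refine (h1.mono (Icc_subset_Icc_right hx.2.le)).congr fun y _ => ?_
    rw [Real.rpow_def_of_pos hx.1, div_eq_mul_inv]
  unfold gLeft
  rw [intervalIntegral.integral_deriv_of_contDiffOn_Icc hF hx.1.le]
  have e : x ^ (1 - α x) = x ^ (1 - α 0) * Real.exp ((-α x - -α 0) * Real.log x) := by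
    rw [mul_comm (-α x - -α 0), ← Real.rpow_def_of_pos hx.1, ← Real.rpow_add hx.1]
    congr 1; ring
  rw [e]
  simp only [hG, div_eq_mul_inv]
  ring

/-- The kernel `g_l'` satisfies the bounds of a fractional derivative of any order
`σ > α(0) - 1`. -/
theorem exists_bound_deriv_gLeft {α : ℝ → ℝ} (hα : ContDiffOn ℝ 2 α (Icc 0 1)) {σ : ℝ}
    (hσ : α 0 - 1 < σ) (hσ1 : σ ≤ α 0) : ∃ C, ∀ x ∈ Ioo (0 : ℝ) 1,
      DifferentiableAt ℝ (deriv (gLeft α)) x ∧ |deriv (gLeft α) x| ≤ C * x ^ (-σ) ∧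
      |deriv (deriv (gLeft α)) x| ≤ C * x ^ (-σ - 1) := by
  have := (isSymbol_gLeft hα (ε := σ - (α 0 - 1)) (by linarith) (by linarith)).deriv_bounds
  rwa [show 1 - α 0 + (1 - (σ - (α 0 - 1))) - 1 = -σ by ring,
    show 1 - α 0 + (1 - (σ - (α 0 - 1))) - 2 = -σ - 1 by ring] at this

theorem IsExponent.contDiffOn {α : ℝ → ℝ} {L : ℝ} (hα : IsExponent α L) :
    ContDiffOn ℝ 2 α (Icc 0 1) := by
  refine contDiffOn_of_differentiableOn_deriv (n := 2) fun k hk => hα.diff k ?_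
  have : k ≤ 2 := by exact_mod_cast hk
  omega

theorem contDiffOn_reflect {α : ℝ → ℝ} (hα : ContDiffOn ℝ 2 α (Icc 0 1)) :
    ContDiffOn ℝ 2 (fun x => α (1 - x)) (Icc 0 1) :=
  hα.comp (contDiff_const.sub contDiff_id).contDiffOn
    fun x hx => ⟨by simpa using hx.2, by simpa using hx.1⟩

/-! ### Bounded operators on `H^s_0` -/

theorem integrable_diffQuot_sq {s : ℝ} (hs : s ∈ Ioo (0 : ℝ) 1) (φ : Test) :
    Integrable fun p => diffQuot s φ p ^ 2 := by
  have h := memLp_diffQuot hs φ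
  exact (memLp_two_iff_integrable_sq h.1).1 h

theorem deriv_test_add (φ ψ : Test) (x : ℝ) :
    deriv (φ + ψ : Test) x = deriv φ x + deriv ψ x := by
  rw [FunLike.coe_add]
  exact (((isC1Zero_test φ).hasDerivAt x).add ((isC1Zero_test ψ).hasDerivAt x)).deriv

theorem deriv_test_smul (k : ℝ) (φ : Test) (x : ℝ) :
    deriv (k • φ : Test) x = k * deriv φ x := by
  rw [FunLike.coe_smul]
  exact (((isC1Zero_test φ).hasDerivAt x).const_smul k).deriv

section
variable {κ : ℝ → ℝ} {C σ : ℝ}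

theorem convL_add {p q : ℝ → ℝ} (hκ : Measurable κ) (hσ : σ < 1)
    (hb : ∀ z ∈ Ioo (0 : ℝ) 1, |κ z| ≤ C * z ^ (-σ)) (hp : Continuous p) (hq : Continuous q)
    {x : ℝ} (hx : x ∈ Icc (0 : ℝ) 1) :
    convL κ (fun t => p t + q t) x = convL κ p x + convL κ q x := by
  rcases eq_or_lt_of_le hx.1 with h0 | h0
  · simp [convL, ← h0]
  · unfold convL
    rw [← intervalIntegral.integral_add (intervalIntegrable_kernel hκ hσ hb hp ⟨h0, hx.2⟩)
      (intervalIntegrable_kernel hκ hσ hb hq ⟨h0, hx.2⟩)]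
    simp only [mul_add]

theorem convL_const_mul (k : ℝ) (q : ℝ → ℝ) (x : ℝ) :
    convL κ (fun t => k * q t) x = k * convL κ q x := by
  unfold convL
  rw [← intervalIntegral.integral_const_mul]
  simp only [mul_left_comm]

theorem isBddOp_convL {s D : ℝ} (hs : s ∈ Ioo (0 : ℝ) 1) (hκ : Measurable κ) (hσ : σ < 1)
    (hb : ∀ z ∈ Ioo (0 : ℝ) 1, |κ z| ≤ C * z ^ (-σ)) (hD : 0 ≤ D)
    (h : ∀ w, IsC1Zero w → Integrable (fun p => diffQuot s w p ^ 2) →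
      MemLp (convL κ (deriv w)) 2 (volume.restrict (Ioc (0 : ℝ) 1)) ∧
      ∫ x in Ioc (0 : ℝ) 1, convL κ (deriv w) x ^ 2 ≤ D * semi s w) :
    IsBddOp s (fun φ => convL κ (deriv φ)) where
  add φ ψ x hx := by
    rw [funext (deriv_test_add φ ψ), convL_add hκ hσ hb (isC1Zero_test φ).continuous_deriv
      (isC1Zero_test ψ).continuous_deriv (Ioc_subset_Icc_self hx)]
  smul k φ x hx := by
    rw [funext (deriv_test_smul k φ), convL_const_mul]
  memLp φ := (h φ (isC1Zero_test φ) (integrable_diffQuot_sq hs φ)).1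
  bound := ⟨D, fun φ => (h φ (isC1Zero_test φ) (integrable_diffQuot_sq hs φ)).2.trans
    (mul_le_mul_of_nonneg_left (le_add_of_nonneg_left (integral_nonneg fun _ => sq_nonneg _)) hD)⟩

/-- The right-sided operators `ψ ↦ ∫_x^1 κ(t-x) (b ψ)'(t) dt` with a coefficient `b`. -/
theorem isBddOp_convR_mul {s D E : ℝ} {b : ℝ → ℝ} (hκ : Measurable κ) (hσ : σ < 1)
    (hb : ∀ z ∈ Ioo (0 : ℝ) 1, |κ z| ≤ C * z ^ (-σ)) (hD : 0 ≤ D)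
    (h : ∀ w, IsC1Zero w → Integrable (fun p => diffQuot s w p ^ 2) →
      MemLp (convL κ (deriv w)) 2 (volume.restrict (Ioc (0 : ℝ) 1)) ∧
      ∫ x in Ioc (0 : ℝ) 1, convL κ (deriv w) x ^ 2 ≤ D * semi s w)
    (hE : ∀ φ : Test, IsC1Zero (fun x => b x * φ x) ∧
      Integrable (fun p => diffQuot s (fun x => b x * φ x) p ^ 2) ∧
      semi s (fun x => b x * φ x) ≤ E * ((∫ x, φ x ^ 2) + semi s φ)) :
    IsBddOp s (fun φ => convR κ (deriv fun x => b x * φ x)) where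
  add φ ψ x hx := by
    have e : ∀ t, deriv (fun x => b x * (φ + ψ : Test) x) t =
        deriv (fun x => b x * φ x) t + deriv (fun x => b x * ψ x) t := by
      intro t
      rw [← (((hE φ).1.hasDerivAt t).add ((hE ψ).1.hasDerivAt t)).deriv]
      congr 1
      ext x
      simp [mul_add]
    rw [funext e]
    simp only [convR_eq_convL]
    exact convL_add hκ hσ hb ((hE φ).1.continuous_deriv.comp (by fun_prop))
      ((hE ψ).1.continuous_deriv.comp (by fun_prop)) ⟨by linarith [hx.2], by linarith [hx.1]⟩
  smul k φ x hx := by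
    have e : ∀ t, deriv (fun x => b x * (k • φ : Test) x) t =
        k * deriv (fun x => b x * φ x) t := by
      intro t
      rw [← (((hE φ).1.hasDerivAt t).const_mul k).deriv]
      congr 1
      ext x
      simp [mul_left_comm]
    rw [funext e]
    simp only [convR_eq_convL]
    exact convL_const_mul k _ _
  memLp φ := (bound_convR_of_convL h (hE φ).1 (hE φ).2.1).1
  bound := ⟨D * E, fun φ => (bound_convR_of_convL h (hE φ).1 (hE φ).2.1).2.trans (by
    rw [mul_assoc]; exact mul_le_mul_of_nonneg_left (hE φ).2.2 hD)⟩

theorem isBddOp_convR {s D : ℝ} (hs : s ∈ Ioo (0 : ℝ) 1) (hκ : Measurable κ) (hσ : σ < 1)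
    (hb : ∀ z ∈ Ioo (0 : ℝ) 1, |κ z| ≤ C * z ^ (-σ)) (hD : 0 ≤ D)
    (h : ∀ w, IsC1Zero w → Integrable (fun p => diffQuot s w p ^ 2) →
      MemLp (convL κ (deriv w)) 2 (volume.restrict (Ioc (0 : ℝ) 1)) ∧
      ∫ x in Ioc (0 : ℝ) 1, convL κ (deriv w) x ^ 2 ≤ D * semi s w) :
    IsBddOp s (fun φ => convR κ (deriv φ)) := by
  have := isBddOp_convR_mul (b := fun _ => 1) (E := 1) hκ hσ hb hD h fun φ => by
    simp only [one_mul]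
    exact ⟨isC1Zero_test φ, integrable_diffQuot_sq hs φ,
      le_add_of_nonneg_left (integral_nonneg fun _ => sq_nonneg _)⟩
  simpa only [one_mul] using this

end

theorem setIntegral_test_sq_le (φ : Test) : ∫ x in Ioc (0 : ℝ) 1, φ x ^ 2 ≤ ∫ x, φ x ^ 2 := by
  refine setIntegral_le_integral ?_ (Filter.Eventually.of_forall fun x => sq_nonneg _)
  have h : MemLp (φ : ℝ → ℝ) 2 volume :=
    φ.continuous.memLp_of_hasCompactSupport φ.hasCompactSupport
  exact (memLp_two_iff_integrable_sq h.1).1 h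

theorem memLp_test (φ : Test) : MemLp (φ : ℝ → ℝ) 2 (volume.restrict (Ioc (0 : ℝ) 1)) :=
  MemLp.restrict _ (φ.continuous.memLp_of_hasCompactSupport φ.hasCompactSupport)

theorem isBddOp_mul {s M : ℝ} {c : ℝ → ℝ}
    (hc : AEStronglyMeasurable c (volume.restrict (Icc (0 : ℝ) 1)))
    (hM : ∀ x ∈ Icc (0 : ℝ) 1, |c x| ≤ M) : IsBddOp s (fun φ x => c x * φ x) := by
  have hc' : AEStronglyMeasurable c (volume.restrict (Ioc (0 : ℝ) 1)) :=
    hc.mono_measure (Measure.restrict_mono Ioc_subset_Icc_self le_rfl)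
  have hM' : ∀ᵐ x ∂(volume.restrict (Ioc (0 : ℝ) 1)), ‖c x‖ ≤ M := by
    filter_upwards [ae_restrict_mem measurableSet_Ioc] with x hx using hM x (Ioc_subset_Icc_self hx)
  have hm : ∀ φ : Test, MemLp (fun x => c x * φ x) 2 (volume.restrict (Ioc (0 : ℝ) 1)) := by
    intro φ
    refine (memLp_test φ).of_le_mul (c := M) (hc'.mul (memLp_test φ).1) ?_
    filter_upwards [hM'] with x hx
    rw [norm_mul]
    exact mul_le_mul_of_nonneg_right hx (norm_nonneg _)
  refine ⟨fun φ ψ x _ => ?_, fun k φ x _ => ?_, hm, M ^ 2, fun φ => ?_⟩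
  · simp [mul_add]
  · simp [mul_left_comm]
  · have h1 : ∫ x in Ioc (0 : ℝ) 1, (c x * φ x) ^ 2 ≤ ∫ x in Ioc (0 : ℝ) 1, M ^ 2 * φ x ^ 2 := by
      refine integral_mono_ae ((memLp_two_iff_integrable_sq (hm φ).1).1 (hm φ))
        (((memLp_two_iff_integrable_sq (memLp_test φ).1).1 (memLp_test φ)).const_mul _) ?_
      filter_upwards [hM'] with x hx
      rw [mul_pow, ← sq_abs (c x)]
      exact mul_le_mul_of_nonneg_right (pow_le_pow_left₀ (abs_nonneg _) hx 2) (sq_nonneg _)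
    rw [integral_const_mul] at h1
    refine h1.trans (mul_le_mul_of_nonneg_left ?_ (sq_nonneg _))
    exact (setIntegral_test_sq_le φ).trans (le_add_of_nonneg_right (semi_nonneg _ _))

theorem isBddOp_id {s : ℝ} : IsBddOp s (fun φ => φ) := by
  have := isBddOp_mul (s := s) (M := 1) (c := fun _ => 1) (by fun_prop) (by simp)
  simpa only [one_mul] using this

/-- The fractional derivatives of order at most `s` are bounded from the seminorm of order `s` to
`L²(0,1)`.  The kernel of order exactly `s` is too singular for `exists_bound_convL`; for it the energy
identity is used. -/
theorem exists_bound_convL_rpow {s β : ℝ} (hs : s ∈ Ioo (1 / 2 : ℝ) 1) (hβs : β ≤ s) :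
    ∃ D, 0 ≤ D ∧ ∀ w, IsC1Zero w → Integrable (fun p => diffQuot s w p ^ 2) →
      MemLp (convL (fun z => z ^ (-β)) (deriv w)) 2 (volume.restrict (Ioc (0 : ℝ) 1)) ∧
      ∫ x in Ioc (0 : ℝ) 1, convL (fun z => z ^ (-β)) (deriv w) x ^ 2 ≤ D * semi s w := by
  have hs0 : s ∈ Ioo (0 : ℝ) 1 := ⟨by linarith [hs.1], hs.2⟩
  rcases eq_or_lt_of_le hβs with h | h
  · rw [h]
    obtain ⟨c, hc0, hc⟩ := integral_convL_sq_le hs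
    refine ⟨c * (s * (2 * s - 1)), ?_, fun w hw hq => ?_⟩
    · have := hs.1
      exact mul_nonneg hc0 (mul_nonneg (by linarith) (by linarith))
    obtain ⟨h1, h2⟩ := hc (deriv w) hw.continuous_deriv fun x hx => hw.deriv_zero_off hx
    rw [integral_energy_abs hw hs hq, ← mul_assoc] at h2
    refine ⟨(memLp_two_iff_integrable_sq ?_).2 h1, h2⟩
    exact stronglyMeasurable_convL (by fun_prop) hw.continuous_deriv
  · have hd : ∀ z ∈ Ioo (0 : ℝ) 1, HasDerivAt (fun z : ℝ => z ^ (-β)) (-β * z ^ (-β - 1)) z :=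
      fun z hz => Real.hasDerivAt_rpow_const (Or.inl hz.1.ne')
    refine exists_bound_convL (C := 1 + |β|) hs0 h (by fun_prop)
      (fun z hz => (hd z hz).differentiableAt) (fun z hz => ?_) (fun z hz => ?_)
    · have := Real.rpow_nonneg hz.1.le (-β)
      rw [abs_of_nonneg this]
      exact le_mul_of_one_le_left this (by linarith [abs_nonneg β])
    · have := Real.rpow_nonneg hz.1.le (-β - 1)
      rw [(hd z hz).deriv, abs_mul, abs_neg, abs_of_nonneg this]
      exact mul_le_mul_of_nonneg_right (by linarith) this

theorem abs_rpow_le {β : ℝ} : ∀ z ∈ Ioo (0 : ℝ) 1, |z ^ (-β)| ≤ 1 * z ^ (-β) := fun z hz => by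
  rw [one_mul, abs_of_nonneg (Real.rpow_nonneg hz.1.le _)]

/-! ### Multiplication by a coefficient and the advection term -/

theorem isC1Zero_mul {b : ℝ → ℝ} (hb : ContDiffOn ℝ 1 b (Icc 0 1)) (φ : Test) :
    IsC1Zero (fun x => b x * φ x) where
  contDiff := by
    rw [contDiff_iff_contDiffAt]
    intro x
    by_cases hx : x ∈ tsupport φ
    · have h := φ.tsupport_subset hx
      exact (hb.contDiffAt (Icc_mem_nhds h.1 h.2)).mul ((isC1Zero_test φ).contDiff.contDiffAt)
    · have h : (fun x => b x * φ x) =ᶠ[nhds x] fun _ => 0 := by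
        filter_upwards [(isClosed_tsupport (φ : ℝ → ℝ)).isOpen_compl.mem_nhds hx] with y hy
        rw [image_eq_zero_of_notMem_tsupport hy, mul_zero]
      exact contDiffAt_const.congr_of_eventuallyEq h
  zero_off x hx := by rw [(isC1Zero_test φ).zero_off x hx, mul_zero]

/-- Multiplication by a `C^1` coefficient is bounded in the `H^s` norm. -/
theorem exists_semi_mul_le {s : ℝ} (hs : s ∈ Ioo (0 : ℝ) 1) {b : ℝ → ℝ}
    (hb : ContDiffOn ℝ 1 b (Icc 0 1)) : ∃ E, ∀ φ : Test,
      Integrable (fun p => diffQuot s (fun x => b x * φ x) p ^ 2) ∧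
      semi s (fun x => b x * φ x) ≤ E * ((∫ x, φ x ^ 2) + semi s φ) := by
  have hU : UniqueDiffOn ℝ (Icc (0 : ℝ) 1) := uniqueDiffOn_Icc zero_lt_one
  obtain ⟨A, hA⟩ := isCompact_Icc.exists_bound_of_continuousOn hb.continuousOn
  obtain ⟨K, hK⟩ := isCompact_Icc.exists_bound_of_continuousOn (hb.continuousOn_derivWithin hU le_rfl)
  have hLip : ∀ x ∈ Icc (0 : ℝ) 1, ∀ y ∈ Icc (0 : ℝ) 1, |b x - b y| ≤ K * |x - y| :=
    fun x hx y hy => Convex.norm_image_sub_le_of_norm_derivWithin_le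
      (hb.differentiableOn one_ne_zero) hK (convex_Icc 0 1) hy hx
  set ρ : ℝ → ℝ := fun h => min (K ^ 2 * h ^ 2) ((2 * A) ^ 2) / |h| ^ (1 + 2 * s) with hρ
  have hρi : Integrable ρ := integrable_majorant hs (sq_nonneg K) (sq_nonneg _)
  have hρ0 : ∀ h, 0 ≤ ρ h := fun h => by simp only [hρ]; positivity
  refine ⟨2 * A ^ 2 + 2 * ∫ h, ρ h, fun φ => ?_⟩
  have hw := isC1Zero_mul hb φ
  have hφm : MemLp (φ : ℝ → ℝ) 2 volume :=
    φ.continuous.memLp_of_hasCompactSupport φ.hasCompactSupport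
  have hφi : Integrable fun x => φ x ^ 2 := (memLp_two_iff_integrable_sq hφm.1).1 hφm
  have hq := integrable_diffQuot_sq hs φ
  have hz := (isC1Zero_test φ).zero_off
  have i2 : Integrable fun p : ℝ × ℝ => φ p.2 ^ 2 * ρ (p.1 - p.2) :=
    hφi.convolution_integrand (ContinuousLinearMap.mul ℝ ℝ) hρi
  have e2 : ∫ p : ℝ × ℝ, φ p.2 ^ 2 * ρ (p.1 - p.2) = (∫ x, φ x ^ 2) * ∫ h, ρ h := by
    rw [Measure.volume_eq_prod] at i2 ⊢
    rw [integral_prod_symm _ i2, ← integral_mul_const]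
    refine integral_congr_ae (Filter.Eventually.of_forall fun y => ?_)
    simp only [integral_const_mul]
    rw [integral_sub_right_eq_self ρ y]
  have pt : ∀ p : ℝ × ℝ, diffQuot s (fun x => b x * φ x) p ^ 2 ≤
      2 * A ^ 2 * diffQuot s φ p ^ 2 + 2 * (φ p.2 ^ 2 * ρ (p.1 - p.2)) := by
    rintro ⟨x, y⟩
    have hd : (|x - y| ^ (1 / 2 + s)) ^ 2 = |x - y| ^ (1 + 2 * s) := by
      rw [← Real.rpow_natCast, ← Real.rpow_mul (abs_nonneg _)]; congr 1; push_cast; ring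
    simp only [diffQuot, div_pow, hρ, hd]
    rw [mul_div_assoc', mul_div_assoc', mul_div_assoc', ← add_div]
    refine div_le_div_of_nonneg_right ?_ (Real.rpow_nonneg (abs_nonneg _) _)
    have m0 : 0 ≤ min (K ^ 2 * (x - y) ^ 2) ((2 * A) ^ 2) := by positivity
    have key : ∀ {z : ℝ}, z ∈ Icc (0 : ℝ) 1 → b z ^ 2 ≤ A ^ 2 := fun {z} hz => by
      rw [← sq_abs]; exact pow_le_pow_left₀ (abs_nonneg _) (hA z hz) 2
    have n1 := sq_nonneg (φ x - φ y)
    have n2 := mul_nonneg (sq_nonneg (φ y)) m0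
    by_cases hx : x ∈ Icc (0 : ℝ) 1
    · by_cases hy : y ∈ Icc (0 : ℝ) 1
      · have hm : (b x - b y) ^ 2 ≤ min (K ^ 2 * (x - y) ^ 2) ((2 * A) ^ 2) := by
          refine le_min ?_ ?_
          · rw [← sq_abs, ← sq_abs (x - y), ← mul_pow]
            exact pow_le_pow_left₀ (abs_nonneg _) (hLip x hx y hy) 2
          · rw [← sq_abs]
            refine pow_le_pow_left₀ (abs_nonneg _) ?_ 2
            have h1 := hA x hx
            have h2 := hA y hy
            rw [Real.norm_eq_abs] at h1 h2
            linarith [abs_sub (b x) (b y)]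
        have e : b x * φ x - b y * φ y = b x * (φ x - φ y) + (b x - b y) * φ y := by ring
        rw [e]
        refine add_sq_le.trans ?_
        rw [mul_pow, mul_pow]
        nlinarith [mul_le_mul_of_nonneg_right (key hx) n1,
          mul_le_mul_of_nonneg_right hm (sq_nonneg (φ y))]
      · have h0 := hz y fun h => hy (Ioo_subset_Icc_self h)
        rw [h0] at n1 n2 ⊢
        rw [mul_zero, sub_zero, mul_pow]
        nlinarith [mul_le_mul_of_nonneg_right (key hx) n1, mul_nonneg (sq_nonneg A) n1]
    · have h0 := hz x fun h => hx (Ioo_subset_Icc_self h)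
      rw [h0] at n1 ⊢
      by_cases hy : y ∈ Icc (0 : ℝ) 1
      · rw [mul_zero, zero_sub, neg_sq, mul_pow]
        nlinarith [mul_le_mul_of_nonneg_right (key hy) n1, mul_nonneg (sq_nonneg A) n1]
      · have h1 := hz y fun h => hy (Ioo_subset_Icc_self h)
        simp [h1]
  have hmaj := (hq.const_mul (2 * A ^ 2)).add (i2.const_mul 2)
  have hi : Integrable fun p => diffQuot s (fun x => b x * φ x) p ^ 2 := by
    have hm : Measurable (diffQuot s fun x => b x * φ x) := by
      have := hw.continuous.measurable
      unfold diffQuot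
      exact Measurable.div ((this.comp measurable_fst).sub (this.comp measurable_snd)) (by fun_prop)
    refine hmaj.mono' (hm.pow_const 2).aestronglyMeasurable (Filter.Eventually.of_forall fun p => ?_)
    rw [Real.norm_of_nonneg (sq_nonneg _)]
    exact pt p
  refine ⟨hi, ?_⟩
  have h1 := integral_mono hi hmaj pt
  simp only [Pi.add_apply] at h1
  rw [integral_add (hq.const_mul _) (i2.const_mul 2), integral_const_mul, integral_const_mul, e2] at h1
  refine h1.trans ?_
  have p1 : 0 ≤ ∫ x, φ x ^ 2 := integral_nonneg fun _ => sq_nonneg _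
  have p2 : 0 ≤ ∫ h, ρ h := integral_nonneg hρ0
  change 2 * A ^ 2 * semi s φ + _ ≤ _
  nlinarith [mul_nonneg (sq_nonneg A) p1, mul_nonneg p2 (semi_nonneg s φ)]

/-- The duality `∫ u' w` as a product of a left-sided derivative of order `γ` and a right-sided one
of order `1 - γ`. -/
theorem integral_convL_mul_convR_one {γ : ℝ} (hγ : γ ∈ Ioo (0 : ℝ) 1) :
    ∃ B : ℝ, 0 < B ∧ ∀ u w : ℝ → ℝ, IsC1Zero u → IsC1Zero w →
      ∫ x in (0 : ℝ)..1, convL (fun z => z ^ (-γ)) (deriv u) x *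
        convR (fun z => z ^ (-(1 - γ))) (deriv w) x = -B * ∫ x, deriv u x * w x := by
  obtain ⟨B, hB, h⟩ := integral_convL_mul_convR hγ (δ := 1 - γ) ⟨by linarith [hγ.2], by linarith [hγ.1]⟩
  refine ⟨B, hB, fun u w hu hw => ?_⟩
  have hu0 := fun x hx => hu.deriv_zero_off (x := x) hx
  have hw0 := fun x hx => hw.deriv_zero_off (x := x) hx
  rw [h _ _ hu.continuous_deriv hw.continuous_deriv hu0 hw0, neg_mul, ← mul_neg]
  congr 1
  rw [show γ + (1 - γ) - 1 = 0 by ring]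
  have k1 : IntegrableOn (fun h => powPos 0 (-h)) (Icc (-1) 1) := by
    have h1 : IntegrableOn (powPos 0) (Icc (-1) 1) :=
      (integrableOn_powPos one_pos 1).mono_set Icc_subset_Iic_self
    simpa using h1.comp_neg
  have k2 := integrable_kernel_prod k1 hu.continuous_deriv hw.continuous_deriv hu0 hw0
  simp only [neg_sub] at k2
  rw [Measure.volume_eq_prod] at k2 ⊢
  rw [integral_prod_symm _ k2]
  have inner : ∀ y, ∫ x, powPos 0 (y - x) * (deriv u x * deriv w y) = u y * deriv w y := by
    intro y
    rw [← hu.hasCompactSupport.integral_Iic_deriv_eq hu.contDiff y, integral_Iic_eq_integral_Iio,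
      ← integral_mul_const, ← integral_indicator measurableSet_Iio]
    refine integral_congr_ae (Filter.Eventually.of_forall fun x => ?_)
    simp only
    rcases lt_or_ge x y with h0 | h0
    · rw [indicator_of_mem (mem_Iio.2 h0), powPos_of_pos (sub_pos.2 h0), neg_zero, Real.rpow_zero,
        one_mul]
    · rw [indicator_of_notMem (notMem_Iio.2 h0), powPos_of_nonpos (sub_nonpos.2 h0), zero_mul]
  simp only [inner]
  have cu := hu.continuous
  have cu' := hu.continuous_deriv
  have cw := hw.continuous
  have cw' := hw.continuous_deriv
  exact integral_mul_deriv_eq_deriv_mul_of_integrable (fun x _ => hu.hasDerivAt x)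
    (fun x _ => hw.hasDerivAt x)
    (Continuous.integrable_of_hasCompactSupport (by fun_prop) hu.hasCompactSupport.mul_right)
    (Continuous.integrable_of_hasCompactSupport (by fun_prop) hw.hasCompactSupport.mul_left)
    (Continuous.integrable_of_hasCompactSupport (by fun_prop) hu.hasCompactSupport.mul_right)

/-- The advection term is a bounded bilinear form on `H^s_0` for `s > 1/2`. -/
theorem isInduced_advection {s : ℝ} (hs : s ∈ Ioo (1 / 2 : ℝ) 1) (hs0 : s ∈ Ioo (0 : ℝ) 1)
    {b : ℝ → ℝ} (hb : ContDiffOn ℝ 1 b (Icc 0 1)) :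
    IsInduced (ofTest hs0) (fun φ ψ => ∫ x in (0 : ℝ)..1, b x * deriv φ x * ψ x) := by
  obtain ⟨B, hB, h⟩ := integral_convL_mul_convR_one hs0
  obtain ⟨D, hD, hD'⟩ := exists_bound_convL_rpow hs (le_refl s)
  obtain ⟨D1, hD1, hD1'⟩ := exists_bound_convL_rpow hs (β := 1 - s) (by linarith [hs.1])
  obtain ⟨E, hE⟩ := exists_semi_mul_le hs0 hb
  have ha := (IsBddOp.isInduced hs0
    (isBddOp_convL hs0 (by fun_prop) hs.2 abs_rpow_le hD hD')
    (isBddOp_convR_mul (b := b) (by fun_prop) (by linarith [hs.1]) abs_rpow_le hD1 hD1'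
      fun φ => ⟨isC1Zero_mul hb φ, hE φ⟩)).const_mul (-B⁻¹)
  refine ha.congr fun φ ψ => ?_
  have e : ∫ x in (0 : ℝ)..1, b x * deriv φ x * ψ x = ∫ x, deriv φ x * (b x * ψ x) := by
    rw [intervalIntegral.integral_of_le zero_le_one, ← integral_indicator measurableSet_Ioc]
    refine integral_congr_ae (Filter.Eventually.of_forall fun x => ?_)
    simp only
    by_cases hx : x ∈ Ioc (0 : ℝ) 1
    · rw [indicator_of_mem hx]; ring
    · rw [indicator_of_notMem hx, (isC1Zero_test φ).deriv_zero_off fun h => hx (Ioo_subset_Ioc_self h),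
        zero_mul]
  rw [h _ _ (isC1Zero_test φ) (isC1Zero_mul hb ψ), e]
  field_simp

/-! ### Coercivity and solvability -/

theorem leftInt_eq (β : ℝ) (q : ℝ → ℝ) (x : ℝ) :
    leftInt (1 - β) q x = (Real.Gamma (1 - β))⁻¹ * convL (fun z => z ^ (-β)) q x := by
  unfold leftInt convL
  rw [← intervalIntegral.integral_const_mul, show 1 - β - 1 = -β by ring]
  simp only [div_eq_inv_mul, mul_assoc]

theorem rightInt_eq (β : ℝ) (q : ℝ → ℝ) (x : ℝ) :
    rightInt (1 - β) q x = (Real.Gamma (1 - β))⁻¹ * convR (fun z => z ^ (-β)) q x := by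
  unfold rightInt convR
  rw [← intervalIntegral.integral_const_mul, show 1 - β - 1 = -β by ring]
  simp only [div_eq_inv_mul, mul_assoc]

theorem integral_leftInt_mul_rightInt (β : ℝ) (p q : ℝ → ℝ) :
    ∫ x in (0 : ℝ)..1, leftInt (1 - β) p x * rightInt (1 - β) q x =
      ((Real.Gamma (1 - β))⁻¹) ^ 2 * ∫ x in (0 : ℝ)..1,
        convL (fun z => z ^ (-β)) p x * convR (fun z => z ^ (-β)) q x := by
  rw [← intervalIntegral.integral_const_mul]
  refine intervalIntegral.integral_congr fun x _ => ?_
  simp only [leftInt_eq, rightInt_eq]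
  ring

/-- The leading part of the form is continuous on `H^s_0`. -/
theorem isInduced_fractional {s β : ℝ} (hs : s ∈ Ioo (1 / 2 : ℝ) 1) (hs0 : s ∈ Ioo (0 : ℝ) 1)
    (hβs : β ≤ s) : IsInduced (ofTest hs0) (fun φ ψ =>
      ∫ x in (0 : ℝ)..1, leftInt (1 - β) (deriv φ) x * rightInt (1 - β) (deriv ψ) x) := by
  obtain ⟨D, hD, hD'⟩ := exists_bound_convL_rpow hs hβs
  have hβ1 : β < 1 := hβs.trans_lt hs.2
  exact ((IsBddOp.isInduced hs0
    (isBddOp_convL hs0 (by fun_prop) hβ1 abs_rpow_le hD hD')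
    (isBddOp_convR hs0 (by fun_prop) hβ1 abs_rpow_le hD hD')).const_mul _).congr fun φ ψ =>
      (integral_leftInt_mul_rightInt _ _ _).symm

/-- The leading part of the form is a multiple of the squared seminorm. -/
theorem exists_energy_eq {β : ℝ} (hβ : β ∈ Ioo (1 / 2 : ℝ) 1) : ∃ k, 0 < k ∧ ∀ φ : Test,
    ∫ x in (0 : ℝ)..1, leftInt (1 - β) (deriv φ) x * rightInt (1 - β) (deriv φ) x =
      k * semi β φ := by
  have hβ0 : β ∈ Ioo (0 : ℝ) 1 := ⟨by linarith [hβ.1], hβ.2⟩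
  obtain ⟨B, hB, h⟩ := integral_convL_mul_convR hβ0 hβ0
  have hG : 0 < Real.Gamma (1 - β) := Real.Gamma_pos_of_pos (by linarith [hβ.2])
  have h1 : 0 < 2 * β - 1 := by linarith [hβ.1]
  have h2 := hβ0.1
  refine ⟨((Real.Gamma (1 - β))⁻¹) ^ 2 * (B * (β * (2 * β - 1) / 2)), by positivity, fun φ => ?_⟩
  have hφ := isC1Zero_test φ
  rw [integral_leftInt_mul_rightInt, h _ _ hφ.continuous_deriv hφ.continuous_deriv
    (fun x hx => hφ.deriv_zero_off hx) (fun x hx => hφ.deriv_zero_off hx),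
    ← two_mul, integral_energy hφ hβ (integrable_diffQuot_sq hβ0 φ)]
  ring

/-- The convolutions of `φ'` with `κ` from the left and from the right are bounded on `H^s_0`, and
their pairing with `φ` is controlled by the product of the seminorm and the `L²` norm of `φ`. -/
structure IsPerturbationKernel (s : ℝ) (κ : ℝ → ℝ) : Prop where
  left : IsBddOp s (fun φ => convL κ (deriv φ))
  right : IsBddOp s (fun φ => convR κ (deriv φ))
  bound : ∃ D, 0 ≤ D ∧ ∀ φ : Test,
    (∫ x in (0 : ℝ)..1, convL κ (deriv φ) x * φ x) ^ 2 ≤ D * semi s φ * (∫ x, φ x ^ 2) ∧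
    (∫ x in (0 : ℝ)..1, convR κ (deriv φ) x * φ x) ^ 2 ≤ D * semi s φ * (∫ x, φ x ^ 2)

theorem isPerturbationKernel_deriv_gLeft {s : ℝ} (hs : s ∈ Ioo (0 : ℝ) 1) {α : ℝ → ℝ}
    (hα : ContDiffOn ℝ 2 α (Icc 0 1)) (hα0 : α 0 - 1 < s) (hα1 : 1 < α 0) :
    IsPerturbationKernel s (deriv (gLeft α)) := by
  -- an order strictly between that of the kernel and that of the space
  set σ := (α 0 - 1 + s) / 2 with hσ
  have h1 : α 0 - 1 < σ := by linarith
  have h2 : σ < s := by linarith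
  obtain ⟨C, hC⟩ := exists_bound_deriv_gLeft hα h1 (by linarith [hs.2])
  have hb := fun z hz => (hC z hz).2.1
  have hm := measurable_deriv (gLeft α)
  have hσ1 : σ < 1 := h2.trans hs.2
  obtain ⟨D, hD, hD'⟩ := exists_bound_convL hs h2 hm (fun z hz => (hC z hz).1) hb
    (fun z hz => (hC z hz).2.2)
  refine ⟨isBddOp_convL hs hm hσ1 hb hD hD', isBddOp_convR hs hm hσ1 hb hD hD', D, hD, fun φ => ?_⟩
  have key : ∀ {f : ℝ → ℝ}, MemLp f 2 (volume.restrict (Ioc (0 : ℝ) 1)) →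
      ∫ x in Ioc (0 : ℝ) 1, f x ^ 2 ≤ D * semi s φ →
      (∫ x in (0 : ℝ)..1, f x * φ x) ^ 2 ≤ D * semi s φ * (∫ x, φ x ^ 2) := by
    intro f h3 h4
    rw [intervalIntegral.integral_of_le zero_le_one]
    exact (sq_integral_mul_le h3 (memLp_test φ)).trans (mul_le_mul h4 (setIntegral_test_sq_le φ)
      (integral_nonneg fun _ => sq_nonneg _) (mul_nonneg hD (semi_nonneg _ _)))
  have hq := integrable_diffQuot_sq hs φ
  obtain ⟨l1, l2⟩ := hD' φ (isC1Zero_test φ) hq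
  obtain ⟨r1, r2⟩ := bound_convR_of_convL hD' (isC1Zero_test φ) hq
  exact ⟨key l1 l2, key r1 r2⟩

/-- Integration by parts turns the advection and reaction terms into a multiple of the `L²` norm. -/
theorem le_advection_reaction {b c : ℝ → ℝ} {M k : ℝ} (hb : ContDiffOn ℝ 1 b (Icc 0 1))
    (hc : AEStronglyMeasurable c (volume.restrict (Icc (0 : ℝ) 1)))
    (hM : ∀ x ∈ Icc (0 : ℝ) 1, |c x| ≤ M)
    (h : ∀ x ∈ Icc (0 : ℝ) 1, k ≤ c x - derivWithin b (Icc 0 1) x / 2) (φ : Test) :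
    k * ∫ x, φ x ^ 2 ≤ (∫ x in (0 : ℝ)..1, b x * deriv φ x * φ x) +
      ∫ x in (0 : ℝ)..1, c x * φ x * φ x := by
  have hφ := isC1Zero_test φ
  have cφ := hφ.continuous
  have cφ' := hφ.continuous_deriv
  have cb' : ContinuousOn (derivWithin b (Icc 0 1)) (Icc 0 1) :=
    hb.continuousOn_derivWithin (uniqueDiffOn_Icc zero_lt_one) le_rfl
  have i1 : IntervalIntegrable (fun x => derivWithin b (Icc 0 1) x * φ x ^ 2) volume 0 1 :=
    (cb'.mul (by fun_prop)).intervalIntegrable_of_Icc zero_le_one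
  have i2 : IntervalIntegrable (fun x => b x * deriv φ x * φ x) volume 0 1 :=
    ((hb.continuousOn.mul cφ'.continuousOn).mul cφ.continuousOn).intervalIntegrable_of_Icc zero_le_one
  have i3 : IntervalIntegrable (fun x => c x * φ x * φ x) volume 0 1 := by
    rw [intervalIntegrable_iff_integrableOn_Ioc_of_le zero_le_one]
    have hc' : AEStronglyMeasurable c (volume.restrict (Ioc (0 : ℝ) 1)) :=
      hc.mono_measure (Measure.restrict_mono Ioc_subset_Icc_self le_rfl)
    have h1 : IntegrableOn (fun x => φ x * φ x) (Ioc 0 1) :=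
      ((cφ.mul cφ).integrableOn_Icc).mono_set Ioc_subset_Icc_self
    refine (Integrable.bdd_mul h1 (c := M) hc' ?_).congr
      (Filter.Eventually.of_forall fun x => (mul_assoc _ _ _).symm)
    filter_upwards [ae_restrict_mem measurableSet_Ioc] with x hx using hM x (Ioc_subset_Icc_self hx)
  have parts : ∫ x in (0 : ℝ)..1, (derivWithin b (Icc 0 1) x * φ x ^ 2 +
      2 * (b x * deriv φ x * φ x)) = 0 := by
    rw [intervalIntegral.integral_eq_sub_of_hasDerivAt_of_le (f := fun x => b x * φ x ^ 2) zero_le_one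
      (hb.continuousOn.mul (by fun_prop)) (fun x hx => ?_) (i1.add (i2.const_mul 2))]
    · simp only [hφ.zero_off 1 (by simp), hφ.zero_off 0 (by simp)]; ring
    · have h1 := ((hb.differentiableOn one_ne_zero x (Ioo_subset_Icc_self hx)).hasDerivWithinAt).hasDerivAt
        (Icc_mem_nhds hx.1 hx.2)
      refine (h1.mul ((hφ.hasDerivAt x).pow 2)).congr_deriv ?_
      simp only [Pi.pow_apply]
      push_cast; ring
  rw [intervalIntegral.integral_add i1 (i2.const_mul 2), intervalIntegral.integral_const_mul] at parts
  have e : ∫ x, φ x ^ 2 = ∫ x in (0 : ℝ)..1, φ x ^ 2 := by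
    rw [intervalIntegral.integral_of_le zero_le_one, ← integral_indicator measurableSet_Ioc]
    refine integral_congr_ae (Filter.Eventually.of_forall fun x => ?_)
    simp only
    by_cases hx : x ∈ Ioc (0 : ℝ) 1
    · rw [indicator_of_mem hx]
    · rw [indicator_of_notMem hx, hφ.zero_off x fun h => hx (Ioo_subset_Ioc_self h)]
      ring
  have mono : ∫ x in (0 : ℝ)..1, k * φ x ^ 2 ≤
      ∫ x in (0 : ℝ)..1, (c x * φ x * φ x - derivWithin b (Icc 0 1) x * φ x ^ 2 / 2) := by
    refine intervalIntegral.integral_mono_on zero_le_one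
      (Continuous.intervalIntegrable (by fun_prop) _ _) (i3.sub (i1.div_const 2)) fun x hx => ?_
    nlinarith [mul_le_mul_of_nonneg_right (h x hx) (sq_nonneg (φ x))]
  rw [intervalIntegral.integral_sub i3 (i1.div_const 2), intervalIntegral.integral_const_mul,
    intervalIntegral.integral_div] at mono
  rw [e]
  linarith

/-- The form in terms of `convL` and `convR`; `g_r` is `g_l` for the reflected exponent. -/
theorem form_eq (α : ℝ → ℝ) (r : ℝ) (b c u v : ℝ → ℝ) : form α r b c u v =
    r * (∫ x in (0 : ℝ)..1, leftInt (1 - α 0 / 2) (deriv u) x * rightInt (1 - α 0 / 2) (deriv v) x)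
    + (1 - r) * (∫ x in (0 : ℝ)..1,
      leftInt (1 - α 1 / 2) (deriv v) x * rightInt (1 - α 1 / 2) (deriv u) x)
    - r * (∫ x in (0 : ℝ)..1, convL (deriv (gLeft α)) (deriv u) x * v x)
    + (1 - r) * (∫ x in (0 : ℝ)..1,
      convR (deriv (gLeft fun x => α (1 - x))) (deriv u) x * v x)
    + (∫ x in (0 : ℝ)..1, b x * deriv u x * v x) + (∫ x in (0 : ℝ)..1, c x * u x * v x) := by
  simp only [mul_comm (leftInt (1 - α 1 / 2) (deriv v) _)]
  rfl

section
variable {α : ℝ → ℝ} {L r : ℝ}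

theorem IsExponent.orderStar_mem (hα : IsExponent α L) : orderStar α ∈ Ioo (1 / 2 : ℝ) 1 := by
  have h0 := hα.mem 0 (by simp)
  have h1 := hα.mem 1 (by simp)
  unfold orderStar
  constructor
  · linarith [le_max_left (α 0) (α 1), h0.1]
  · linarith [max_lt h0.2 h1.2]

theorem div_two_le_orderStar (α : ℝ → ℝ) : α 0 / 2 ≤ orderStar α ∧ α 1 / 2 ≤ orderStar α := by
  unfold orderStar
  exact ⟨by linarith [le_max_left (α 0) (α 1)], by linarith [le_max_right (α 0) (α 1)]⟩

theorem IsExponent.isPerturbationKernel_left (hα : IsExponent α L)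
    (hs0 : orderStar α ∈ Ioo (0 : ℝ) 1) :
    IsPerturbationKernel (orderStar α) (deriv (gLeft α)) :=
  isPerturbationKernel_deriv_gLeft hs0 hα.contDiffOn
    (by linarith [(div_two_le_orderStar α).1, (hα.mem 0 (by simp)).2])
    (hα.mem 0 (by simp)).1

theorem IsExponent.isPerturbationKernel_right (hα : IsExponent α L)
    (hs0 : orderStar α ∈ Ioo (0 : ℝ) 1) :
    IsPerturbationKernel (orderStar α) (deriv (gLeft fun x => α (1 - x))) :=
  isPerturbationKernel_deriv_gLeft hs0 (contDiffOn_reflect hα.contDiffOn)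
    (by simp only [sub_zero]; linarith [(div_two_le_orderStar α).2, (hα.mem 1 (by simp)).2])
    (by simp only [sub_zero]; exact (hα.mem 1 (by simp)).1)

theorem IsExponent.isInduced_form (hα : IsExponent α L) (hs0 : orderStar α ∈ Ioo (0 : ℝ) 1)
    {b c : ℝ → ℝ} {M : ℝ} (hb : ContDiffOn ℝ 1 b (Icc 0 1))
    (hc : AEStronglyMeasurable c (volume.restrict (Icc (0 : ℝ) 1)))
    (hM : ∀ x ∈ Icc (0 : ℝ) 1, |c x| ≤ M) :
    IsInduced (ofTest hs0) (fun φ ψ => form α r b c φ ψ) := by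
  have hs := hα.orderStar_mem
  have h1 := isInduced_fractional hs hs0 (div_two_le_orderStar α).1
  have h2 := isInduced_fractional hs hs0 (div_two_le_orderStar α).2
  have h3 := IsBddOp.isInduced hs0 (hα.isPerturbationKernel_left hs0).left isBddOp_id
  have h4 := IsBddOp.isInduced hs0 (hα.isPerturbationKernel_right hs0).right isBddOp_id
  have h5 := isInduced_advection hs hs0 hb
  have h6 := IsBddOp.isInduced hs0 (isBddOp_mul hc hM) isBddOp_id
  have h := (((((h1.const_mul r).add (h2.flip.const_mul (1 - r))).sub (h3.const_mul r)).add
    (h4.const_mul (1 - r))).add h5).add h6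
  simpa only [form_eq] using h

/-- Coercivity on test functions.  The leading part controls the seminorm of the highest order; the
perturbations are absorbed by it and by the reaction term. -/
theorem IsExponent.exists_coercive (hα : IsExponent α L) (hr0 : 0 < r) (hr1 : r < 1) :
    ∃ cbar : ℝ, 0 < cbar ∧ ∃ k : ℝ, 0 < k ∧ ∀ (b c : ℝ → ℝ) (M : ℝ), ContDiffOn ℝ 1 b (Icc 0 1) →
      AEStronglyMeasurable c (volume.restrict (Icc (0 : ℝ) 1)) →
      (∀ x ∈ Icc (0 : ℝ) 1, |c x| ≤ M) →
      (∀ x ∈ Icc (0 : ℝ) 1, cbar ≤ c x - derivWithin b (Icc 0 1) x / 2) →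
      ∀ φ : Test, k * ((∫ x, φ x ^ 2) + semi (orderStar α) φ) ≤ form α r b c φ φ := by
  have hs := hα.orderStar_mem
  have hs0 : orderStar α ∈ Ioo (0 : ℝ) 1 := ⟨by linarith [hs.1], hs.2⟩
  have m0 := hα.mem 0 (by simp)
  have m1 := hα.mem 1 (by simp)
  obtain ⟨k0, hk0, e0⟩ := exists_energy_eq (β := α 0 / 2) ⟨by linarith [m0.1], by linarith [m0.2]⟩
  obtain ⟨k1, hk1, e1⟩ := exists_energy_eq (β := α 1 / 2) ⟨by linarith [m1.1], by linarith [m1.2]⟩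
  obtain ⟨D0, hD0, d0⟩ := (hα.isPerturbationKernel_left hs0).bound
  obtain ⟨D1, hD1, d1⟩ := (hα.isPerturbationKernel_right hs0).bound
  have hr1' : 0 < 1 - r := by linarith
  set k := min (r * k0) ((1 - r) * k1) with hk
  have hkpos : 0 < k := lt_min (mul_pos hr0 hk0) (mul_pos hr1' hk1)
  have lead : ∀ φ : Test, k * semi (orderStar α) φ ≤
      r * (k0 * semi (α 0 / 2) φ) + (1 - r) * (k1 * semi (α 1 / 2) φ) := by
    intro φ
    have p0 := mul_nonneg hr0.le (mul_nonneg hk0.le (semi_nonneg (α 0 / 2) φ))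
    have p1 := mul_nonneg hr1'.le (mul_nonneg hk1.le (semi_nonneg (α 1 / 2) φ))
    rcases le_total (α 0) (α 1) with h | h
    · have e : orderStar α = α 1 / 2 := by rw [orderStar, max_eq_right h]
      rw [e]
      have := mul_le_mul_of_nonneg_right (min_le_right (r * k0) ((1 - r) * k1))
        (semi_nonneg (α 1 / 2) φ)
      linarith
    · have e : orderStar α = α 0 / 2 := by rw [orderStar, max_eq_left h]
      rw [e]
      have := mul_le_mul_of_nonneg_right (min_le_left (r * k0) ((1 - r) * k1))
        (semi_nonneg (α 0 / 2) φ)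
      linarith
  set D := max D0 D1 with hD
  have hDnn : 0 ≤ D := hD0.trans (le_max_left _ _)
  -- the arithmetic-geometric mean inequality with weight `k / 4`
  have young : ∀ {g X Y E : ℝ}, 0 ≤ X → 0 ≤ Y → E ≤ D → g ^ 2 ≤ E * X * Y →
      |g| ≤ k / 4 * X + D / k * Y := by
    intro g X Y E hX hY hE hg
    refine abs_le_of_sq_le_sq ?_ (by positivity)
    have h1 : E * X * Y ≤ D * X * Y := by gcongr
    have h2 : k / 4 * (D / k) = D / 4 := by field_simp
    have h3 : (k / 4 * X + D / k * Y) ^ 2 = (k / 4 * X - D / k * Y) ^ 2 + 4 * (k / 4 * (D / k)) * X * Y := by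
      ring
    rw [h3, h2]
    nlinarith [sq_nonneg (k / 4 * X - D / k * Y)]
  refine ⟨D / k + 1, by positivity, min (k / 2) 1, by positivity, ?_⟩
  intro b c M hb hc hM hbc φ
  have hX := semi_nonneg (orderStar α) φ
  have hY : 0 ≤ ∫ x, φ x ^ 2 := integral_nonneg fun _ => sq_nonneg _
  have y0 := young hX hY (le_max_left _ _) (d0 φ).1
  have y1 := young hX hY (le_max_right _ _) (d1 φ).2
  have ar := le_advection_reaction hb hc hM hbc φ
  rw [form_eq, e0, e1]
  have l := lead φ
  have z0 := mul_le_mul_of_nonneg_left ((le_abs_self _).trans y0) hr0.le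
  have z1 := mul_le_mul_of_nonneg_left ((neg_le_abs _).trans y1) hr1'.le
  have w1 := mul_le_mul_of_nonneg_right (min_le_left (k / 2) 1) hX
  have w2 := mul_le_mul_of_nonneg_right (min_le_right (k / 2) 1) hY
  have w3 : 0 ≤ k * semi (orderStar α) φ := mul_nonneg hkpos.le hX
  linarith
end

/-- The Lax-Milgram theorem with the bound of the solution by the data. -/
theorem exists_unique_solution {V : Type*} [NormedAddCommGroup V] [InnerProductSpace ℝ V]
    [CompleteSpace V] (a : V →L[ℝ] V →L[ℝ] ℝ) {k : ℝ} (hk : 0 < k) (ha : ∀ u, k * ‖u‖ ^ 2 ≤ a u u)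
    (f : StrongDual ℝ V) : ∃ u : V, (∀ v, a u v = f v) ∧
      (∀ u', (∀ v, a u' v = f v) → u' = u) ∧ ‖u‖ ≤ k⁻¹ * ‖f‖ := by
  have hco : IsCoercive a := ⟨k, hk, fun u => by rw [mul_assoc, ← sq]; exact ha u⟩
  set e := hco.continuousLinearEquivOfBilin
  have hu : ∀ v, a (e.symm ((InnerProductSpace.toDual ℝ V).symm f)) v = f v := by
    intro v
    rw [← hco.continuousLinearEquivOfBilin_apply, ContinuousLinearEquiv.apply_symm_apply,
      InnerProductSpace.toDual_symm_apply]
  refine ⟨e.symm ((InnerProductSpace.toDual ℝ V).symm f), hu, fun u' hu' => ?_, ?_⟩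
  · set u := e.symm ((InnerProductSpace.toDual ℝ V).symm f)
    have h1 := ha (u' - u)
    rw [a.map_sub, _root_.sub_apply, hu', hu, sub_self] at h1
    have h2 : ‖u' - u‖ ^ 2 ≤ 0 := by
      by_contra h
      exact absurd h1 (not_le.2 (mul_pos hk (not_le.1 h)))
    exact sub_eq_zero.1 (norm_eq_zero.1 (pow_eq_zero_iff two_ne_zero |>.1 (le_antisymm h2 (sq_nonneg _))))
  · set u := e.symm ((InnerProductSpace.toDual ℝ V).symm f)
    have h1 := (ha u).trans_eq (hu u)
    have h2 : f u ≤ ‖f‖ * ‖u‖ := (le_abs_self _).trans (f.le_opNorm u)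
    rcases eq_or_lt_of_le (norm_nonneg u) with h0 | h0
    · rw [← h0]; positivity
    · rw [inv_mul_eq_div, le_div_iff₀ hk]
      exact le_of_mul_le_mul_right (by linarith) h0

theorem exists_bound_bilin {V : Type*} [NormedAddCommGroup V] [NormedSpace ℝ V]
    (a : V →L[ℝ] V →L[ℝ] ℝ) : ∃ C, 0 < C ∧ ∀ u v, |a u v| ≤ C * ‖u‖ * ‖v‖ := by
  refine ⟨‖a‖ + 1, by positivity, fun u v => (a.le_opNorm₂ u v).trans ?_⟩
  gcongr
  linarith

end FracBVP

theorem mainTheorem8 (α : ℝ → ℝ) (L r : ℝ) (hα : FracBVP.IsExponent α L)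
    (hr0 : 0 < r) (hr1 : r < 1) :
    ∃ cbar : ℝ, 0 < cbar ∧ ∀ b c : ℝ → ℝ,
      ContDiffOn ℝ 1 b (Icc 0 1) →
      AEStronglyMeasurable c (volume.restrict (Icc (0 : ℝ) 1)) →
      (∃ M : ℝ, ∀ x ∈ Icc (0 : ℝ) 1, |c x| ≤ M) →
      (∀ x ∈ Icc (0 : ℝ) 1, cbar ≤ c x - derivWithin b (Icc 0 1) x / 2) →
      ∃ a : FracBVP.H0 (FracBVP.orderStar α) →L[ℝ] FracBVP.H0 (FracBVP.orderStar α) →L[ℝ] ℝ,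
        (FracBVP.Extends α r b c a ∧ ∀ a', FracBVP.Extends α r b c a' → a' = a) ∧
        (∃ clow : ℝ, 0 < clow ∧ ∀ u, clow * ‖u‖ ^ 2 ≤ a u u) ∧
        (∃ cup : ℝ, 0 < cup ∧ ∀ u v, |a u v| ≤ cup * ‖u‖ * ‖v‖) ∧
        ∃ Q : ℝ, 0 < Q ∧ ∀ f : FracBVP.Hneg (FracBVP.orderStar α),
          ∃ u : FracBVP.H0 (FracBVP.orderStar α),
            FracBVP.IsSolution a f u ∧ (∀ u', FracBVP.IsSolution a f u' → u' = u) ∧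
            ‖u‖ ≤ Q * ‖f‖ := by
  have hs := hα.orderStar_mem
  have hs0 : FracBVP.orderStar α ∈ Ioo (0 : ℝ) 1 := ⟨by linarith [hs.1], hs.2⟩
  obtain ⟨cbar, hcbar, k, hk, hcoer⟩ := hα.exists_coercive hr0 hr1
  refine ⟨cbar, hcbar, fun b c hb hc ⟨M, hM⟩ hbc => ?_⟩
  obtain ⟨a, ha⟩ := hα.isInduced_form (r := r) hs0 hb hc hM
  have dense := FracBVP.denseRange_ofTest hs0
  have low : ∀ u, k * ‖u‖ ^ 2 ≤ a u u := fun u =>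
    dense.induction_on (p := fun u => k * ‖u‖ ^ 2 ≤ a u u) u
      (isClosed_le (by fun_prop) (by fun_prop)) fun φ => by
        rw [FracBVP.norm_ofTest_sq, ha]
        exact hcoer b c M hb hc hM hbc φ
  refine ⟨a, ⟨fun φ ψ u v hu hv => ?_, fun a' ha' => ?_⟩, ⟨k, hk, low⟩,
    FracBVP.exists_bound_bilin a, k⁻¹, inv_pos.2 hk,
    fun f => FracBVP.exists_unique_solution a hk low f⟩
  · rw [FracBVP.eq_ofTest hs0 hu, FracBVP.eq_ofTest hs0 hv, ha]
  · ext u v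
    refine dense.induction_on₂ (p := fun u v => a' u v = a u v)
      (isClosed_eq (by fun_prop) (by fun_prop)) (fun φ ψ => ?_) u v
    rw [ha, ha' φ ψ _ _ (FracBVP.ofTest_fn hs0 φ) (FracBVP.ofTest_fn hs0 ψ)]
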